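/- Let $k$ be an arbitrary field (not assumed perfect) and let $X$ be a normal projective variety over $k$, i.e. an integral normal scheme, projective over $k$; put $d=\dim X$. An $\mathbb R$-Weil divisor on $X$ is a finite formal sum $D=\sum_i a_iE_i$ with $a_i\in\mathbb R$ and $E_i$ prime divisors, and $D\le D'$ means that the inequality holds for the coefficients at every prime divisor. For such a $D$ put $$\Gamma(X,\mathcal O_X(D))=\{f\in k(X)^{*}\mid \operatorname{div}(f)+D\ge 0\}\cup\{0\}\subset k(X),$$ $$\operatorname{Vol}(D)=\limsup_{n\to\infty}\frac{\dim_k\Gamma(X,\mathcal O_X(nD))}{n^d/d!},$$ and call $D$ big if $\operatorname{Vol}(D)>0$. (The limsup is in fact a limit.) Let $D_1\le D_2$ be big $\mathbb R$-Weil divisors on $X$ with $\operatorname{Vol}(D_1)=\operatorname{Vol}(D_2)$. Then $$\Gamma(X,\mathcal O_X(nD_1))=\Gamma(X,\mathcal O_X(nD_2))$$ as subspaces of $k(X)$, for all $n\in\mathbb N$. -/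

import Mathlib

open AlgebraicGeometry CategoryTheory Order

universe u

noncomputable section

namespace BigDivisor

/-- The standard grading of `k[x₀, …, xₙ]`. -/
abbrev grading (k : Type u) [Field k] (n : ℕ) : ℕ → Submodule k (MvPolynomial (Fin (n + 1)) k) :=
  MvPolynomial.homogeneousSubmodule (Fin (n + 1)) k

instance (k : Type u) [Field k] (n : ℕ) : GradedAlgebra (grading k n) :=
  MvPolynomial.gradedAlgebra

/-- Projective space `ℙⁿ_k = Proj k[x₀, …, xₙ]`. -/
abbrev projectiveSpace (k : Type u) [Field k] (n : ℕ) : Scheme.{u} :=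
  Proj (grading k n)

/-- The structure morphism `ℙⁿ_k ⟶ Spec k`. -/
def projectiveSpaceStr (k : Type u) [Field k] (n : ℕ) :
    projectiveSpace k n ⟶ Spec (CommRingCat.of k) :=
  Proj.toSpecZero (grading k n) ≫
    Spec.map (CommRingCat.ofHom (algebraMap k (grading k n 0)))

/-- A `k`-scheme is projective if it is isomorphic over `k` to a closed subscheme of some
projective space `ℙⁿ_k`. -/
def IsProjectiveOver {k : Type u} [Field k] {X : Scheme.{u}}
    (f : X ⟶ Spec (CommRingCat.of k)) : Prop :=
  ∃ (n : ℕ) (i : X ⟶ projectiveSpace k n), IsClosedImmersion i ∧ i ≫ projectiveSpaceStr k n = f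

instance (k : Type u) [Field k] (n : ℕ) : LocallyOfFiniteType (projectiveSpaceStr k n) := by
  have h0 : Function.Surjective (algebraMap k (grading k n 0)) := by
    rintro ⟨p, hp⟩
    have hp' : p.totalDegree = 0 :=
      Nat.le_zero.mp (MvPolynomial.IsHomogeneous.totalDegree_le
        ((MvPolynomial.mem_homogeneousSubmodule 0 p).mp hp))
    refine ⟨p.coeff 0, Subtype.ext ?_⟩
    exact (MvPolynomial.totalDegree_eq_zero_iff_eq_C.mp hp').symm
  have : IsScalarTower k (grading k n 0) (MvPolynomial (Fin (n + 1)) k) :=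
    IsScalarTower.of_algebraMap_eq (R := k) (S := grading k n 0)
      (A := MvPolynomial (Fin (n + 1)) k) fun _ => rfl
  have : Algebra.FiniteType (grading k n 0) (MvPolynomial (Fin (n + 1)) k) :=
    Algebra.FiniteType.of_restrictScalars_finiteType k _ _
  have : LocallyOfFiniteType
      (Spec.map (CommRingCat.ofHom (algebraMap k (grading k n 0)))) := by
    rw [HasRingHomProperty.Spec_iff (P := @LocallyOfFiniteType)]
    exact RingHom.FiniteType.of_surjective _ h0
  unfold projectiveSpaceStr
  infer_instance

lemma IsProjectiveOver.locallyOfFiniteType {k : Type u} [Field k] {X : Scheme.{u}}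
    {f : X ⟶ Spec (CommRingCat.of k)} (hf : IsProjectiveOver f) : LocallyOfFiniteType f := by
  obtain ⟨n, i, hi, rfl⟩ := hf
  infer_instance

end BigDivisor

/-- A normal projective variety over the field `k`: an integral normal scheme, projective over
`k`. It is neither assumed to be geometrically integral nor geometrically normal. -/
structure NormalProjectiveVariety (k : Type u) [Field k] where
  /-- The underlying scheme. -/
  X : Scheme.{u}
  /-- The structure morphism. -/
  str : X ⟶ Spec (CommRingCat.of k)
  isIntegral : IsIntegral X
  isProjective : BigDivisor.IsProjectiveOver str
  isNormal : ∀ x : X, IsIntegrallyClosed (X.presheaf.stalk x)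

namespace NormalProjectiveVariety

variable {k : Type u} [Field k] (V : NormalProjectiveVariety k)

instance : IsIntegral V.X := V.isIntegral

instance : LocallyOfFiniteType V.str := V.isProjective.locallyOfFiniteType

instance : IsLocallyNoetherian V.X :=
  LocallyOfFiniteType.isLocallyNoetherian V.str

/-- The field of rational functions `k(X)`. -/
abbrev functionField : Type u := V.X.functionField

/-- The ring homomorphism `k → Γ(X, 𝒪_X)` given by the structure morphism. -/
def scalars : k →+* Γ(V.X, ⊤) :=
  V.str.appTop.hom.comp (Scheme.ΓSpecIso (CommRingCat.of k)).inv.hom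

instance : Algebra k V.functionField :=
  ((V.X.presheaf.germ ⊤ (genericPoint V.X) trivial).hom.comp V.scalars).toAlgebra

/-- The dimension of `X`. -/
def dim : ℕ := ((topologicalKrullDim V.X).unbotD 0).toNat

/-- The prime divisors of `X`, given by their generic points, which are the points of
codimension one. -/
abbrev PrimeDivisor : Type u := {x : V.X // coheight x = 1}

/-- The `ℝ`-Weil divisors on `X`: finite formal real linear combinations of prime divisors, with
the coefficientwise order. -/
abbrev RWeilDivisor : Type u := V.PrimeDivisor →₀ ℝ

instance (E : V.PrimeDivisor) : IsDiscreteValuationRing (V.X.presheaf.stalk E.1) := by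
  have h1 : ringKrullDim (V.X.presheaf.stalk E.1) = 1 := by
    rw [ringKrullDim_stalk_eq_coheight E.1, E.2]; rfl
  have : Ring.KrullDimLE 1 (V.X.presheaf.stalk E.1) := krullDimLE_of_coheight_le E.2.le
  have := V.isNormal E.1
  have hf : ¬ IsField (V.X.presheaf.stalk E.1) := by
    intro h
    rw [ringKrullDim_eq_zero_of_isField h] at h1
    exact zero_ne_one h1
  have : Ring.DimensionLEOne (V.X.presheaf.stalk E.1) :=
    ⟨fun hP hP' => Ring.krullDimLE_one_iff_of_noZeroDivisors.mp ‹_› _ hP hP'⟩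
  have : IsDedekindDomain (V.X.presheaf.stalk E.1) := {}
  exact ((IsDiscreteValuationRing.TFAE (V.X.presheaf.stalk E.1) hf).out 0 2).mpr this

/-- The space of global sections
`Γ(X, 𝒪_X(D)) = {f ∈ k(X)ˣ ∣ div f + D ≥ 0} ∪ {0}` for an `ℝ`-Weil divisor `D`,
as a `k`-subspace of `k(X)`. -/
def sections (D : V.RWeilDivisor) : Submodule k V.functionField where
  carrier := {f | f ≠ 0 → ∀ E : V.PrimeDivisor, 0 ≤ (Scheme.ord f E.1 : ℝ) + D E}
  zero_mem' h := absurd rfl h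
  add_mem' {f g} hf hg hfg E := by
    by_cases hf0 : f = 0
    · subst hf0
      rw [zero_add] at hfg ⊢
      exact hg hfg E
    by_cases hg0 : g = 0
    · subst hg0
      rw [add_zero] at hfg ⊢
      exact hf hfg E
    have h := Scheme.ord_add (x := E.1) hfg
    have h1 := hf hf0 E
    have h2 := hg hg0 E
    rcases min_le_iff.mp h with h | h
    · have : (Scheme.ord f E.1 : ℝ) ≤ Scheme.ord (f + g) E.1 := by exact_mod_cast h
      linarith
    · have : (Scheme.ord g E.1 : ℝ) ≤ Scheme.ord (f + g) E.1 := by exact_mod_cast h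
      linarith
  smul_mem' c f hf hcf E := by
    have hne : Nonempty (⊤ : V.X.Opens) := ⟨⟨genericPoint V.X, trivial⟩⟩
    have hsmul : c • f = V.scalars c • f := by
      rw [Algebra.smul_def, Algebra.smul_def]; rfl
    have hf0 : f ≠ 0 := by rintro rfl; exact hcf (smul_zero c)
    rw [hsmul] at hcf ⊢
    have hc0 : V.scalars c ≠ 0 := fun h => hcf (by rw [h, zero_smul])
    have h := Scheme.ord_le_smul (x := E.1) (U := ⊤) trivial hc0 f
    have h' : (Scheme.ord f E.1 : ℝ) ≤ Scheme.ord (V.scalars c • f) E.1 := by exact_mod_cast h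
    have := hf hf0 E
    linarith

/-- The volume
`vol D = limsup_n dim_k Γ(X, 𝒪_X(nD)) / (n ^ d / d!)`, where `d = dim X`. It is taken in `[0, ∞]`,
so that no boundedness is needed for it to be defined. -/
def vol (D : V.RWeilDivisor) : ENNReal :=
  Filter.limsup
    (fun n : ℕ => (Module.finrank k (V.sections (n • D)) : ENNReal) /
      ((n : ENNReal) ^ V.dim / (V.dim.factorial : ENNReal)))
    Filter.atTop

/-- An `ℝ`-Weil divisor is big if its volume is positive. -/
def IsBig (D : V.RWeilDivisor) : Prop := 0 < V.vol D

end NormalProjectiveVariety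

end

/-! Suppose `f` lies in `Γ(m D₁')` for the larger divisor `D₁' = D₂` but not in `Γ(m D₁)`: along
some prime divisor `E` its pole exceeds by some `δ > 0` what `m D₁` allows. For `n = m j + l` the
space `f ^ j · Γ(l D₁)` lies in `Γ(n D₂)`. Orders of vanishing along `E` on `Γ(l D₁)` are at most
linear in `l`, so once `j` is a large multiple of `l + 1` the excess pole `j δ` cannot be
compensated, and this space meets `Γ(n D₁)` only in zero. Hence `dim Γ(n D₂) ≥ dim Γ(n D₁) + dim Γ(l
D₁)` with `l` of the order of a fixed fraction of `n`. As `D₁` is big, the last term is at least a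
positive multiple of `n ^ d` (`exists_finrank_add_le`), and the volumes differ. The gap is available
only where `Γ(n D₁) ≠ 0`, which is enough for a limsup (`limsup_lt_limsup_of_add_le`).

Three facts about subspaces of `k(X)` with linearly growing poles carry the argument. All rest on
Noether normalization, so the field may be arbitrary. Upper bound
(`IsCoordinateSystem.finite_and_finrank_le`): dimensions are `O(n ^ d)`, because the spaces embed
into forms of linearly growing degree. The embedding comes from a common denominator for the
saturation of the homogeneous coordinate ring (`exists_common_conductor`). Lower bound
(`exists_pow_le_finrank`): if the dimensions of a graded system are not `O(n ^ (d - 1))`, ratios of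
sections have full transcendence degree; otherwise powers of a transcendental element would break
the upper bound. Monomials in `d` independent ratios then fill out order `n ^ d`. Order bound
(`exists_order_le`): up to fixed factors a section divides a polynomial of degree `O(n)`, whose
order along `E` is controlled by the power of one prime polynomial dividing it.

Geometry enters through the standard charts of a projective embedding and through the fact that
regularity on a normal affine chart is tested in codimension one. -/

namespace MvPolynomial

/-! ### Dimension of spaces of polynomials of bounded degree. -/

variable {k : Type*} [Field k]

lemma finite_and_finrank_restrictTotalDegree_le (s m : ℕ) :
    Module.Finite k (restrictTotalDegree (Fin s) k m) ∧
      Module.finrank k (restrictTotalDegree (Fin s) k m) ≤ (m + 1) ^ s := by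
  let T : Set (Fin s →₀ ℕ) := {n | (n.sum fun _ e => e) ≤ m}
  have hT : ∀ n ∈ T, ∀ i, n i < m + 1 := by
    intro n hn i
    refine Nat.lt_succ_of_le (le_trans ?_ hn)
    rw [Finsupp.sum_fintype _ _ (fun _ => rfl)]
    exact Finset.single_le_sum (f := fun i => n i) (fun _ _ => Nat.zero_le _) (Finset.mem_univ i)
  let φ : T → (Fin s → Fin (m + 1)) := fun n i => ⟨n.1 i, hT n.1 n.2 i⟩
  have hφ : Function.Injective φ := by
    intro a b h
    ext i
    simpa [φ] using congrArg Fin.val (congrFun h i)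
  have : Finite T := Finite.of_injective φ hφ
  have := Fintype.ofFinite T
  let b : Module.Basis T k (restrictTotalDegree (Fin s) k m) := basisRestrictSupport k T
  refine ⟨Module.Finite.of_basis b, ?_⟩
  rw [Module.finrank_eq_card_basis b]
  simpa using Fintype.card_le_of_injective φ hφ

end MvPolynomial

/-! ### Powers of a subspace in a finite extension of a polynomial ring. -/

section Filtration

open MvPolynomial

variable {k : Type*} [Field k] {B : Type*} [CommRing B] [Algebra k B] {s : ℕ}
  [Algebra (MvPolynomial (Fin s) k) B] [IsScalarTower k (MvPolynomial (Fin s) k) B]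

/-- Multiplication by elements of `W ^ n` is given by matrices of entries of degree `O(n)`. -/
lemma exists_matrix_of_mem_pow {r : ℕ} {ω : Fin r → B}
    (hω : Submodule.span (MvPolynomial (Fin s) k) (Set.range ω) = ⊤)
    (W : Submodule k B) (hW : W.FG) :
    ∃ D : ℕ, ∀ n : ℕ, ∀ x ∈ W ^ n, ∃ M : Matrix (Fin r) (Fin r) (MvPolynomial (Fin s) k),
      (∀ i j, (M i j).totalDegree ≤ D * n) ∧ ∀ i, x * ω i = ∑ j, M i j • ω j := by
  classical
  have hrep : ∀ x : B, ∃ M : Matrix (Fin r) (Fin r) (MvPolynomial (Fin s) k),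
      ∀ i, x * ω i = ∑ j, M i j • ω j := by
    intro x
    have : ∀ i, ∃ c : Fin r → MvPolynomial (Fin s) k, ∑ j, c j • ω j = x * ω i := fun i =>
      (Submodule.mem_span_range_iff_exists_fun _).mp (hω ▸ Submodule.mem_top)
    choose c hc using this
    exact ⟨c, fun i => (hc i).symm⟩
  obtain ⟨w, rfl⟩ := hW
  choose M hM using hrep
  let D := w.sup fun x => Finset.univ.sup fun i => Finset.univ.sup fun j =>
    (M x i j).totalDegree
  have hD : ∀ x ∈ w, ∀ i j, (M x i j).totalDegree ≤ D := fun x hx i j =>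
    le_trans (le_trans (Finset.le_sup (f := fun j => (M x i j).totalDegree) (Finset.mem_univ j))
      (Finset.le_sup (f := fun i => Finset.univ.sup fun j => (M x i j).totalDegree)
        (Finset.mem_univ i)))
      (Finset.le_sup (f := fun x => Finset.univ.sup fun i => Finset.univ.sup fun j =>
        (M x i j).totalDegree) hx)
  have hadd : ∀ (n : ℕ) (x y : B),
      (∃ M : Matrix (Fin r) (Fin r) (MvPolynomial (Fin s) k),
        (∀ i j, (M i j).totalDegree ≤ n) ∧ ∀ i, x * ω i = ∑ j, M i j • ω j) →
      (∃ M : Matrix (Fin r) (Fin r) (MvPolynomial (Fin s) k),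
        (∀ i j, (M i j).totalDegree ≤ n) ∧ ∀ i, y * ω i = ∑ j, M i j • ω j) →
      ∃ M : Matrix (Fin r) (Fin r) (MvPolynomial (Fin s) k),
        (∀ i j, (M i j).totalDegree ≤ n) ∧ ∀ i, (x + y) * ω i = ∑ j, M i j • ω j := by
    rintro n x y ⟨M₁, h₁, h₁'⟩ ⟨M₂, h₂, h₂'⟩
    refine ⟨M₁ + M₂, fun i j => ?_, fun i => ?_⟩
    · exact (totalDegree_add _ _).trans (max_le (h₁ i j) (h₂ i j))
    · simp only [add_mul, h₁', h₂', Matrix.add_apply, add_smul, Finset.sum_add_distrib]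
  have hspan : ∀ x ∈ Submodule.span k (w : Set B),
      ∃ M : Matrix (Fin r) (Fin r) (MvPolynomial (Fin s) k),
        (∀ i j, (M i j).totalDegree ≤ D) ∧ ∀ i, x * ω i = ∑ j, M i j • ω j := by
    intro x hx
    induction hx using Submodule.span_induction with
    | mem x hx => exact ⟨M x, hD x hx, hM x⟩
    | zero => exact ⟨0, by simp, by simp⟩
    | add x y _ _ hx hy => exact hadd D x y hx hy
    | smul c x _ hx =>
      obtain ⟨M, h, h'⟩ := hx
      refine ⟨c • M, fun i j => (totalDegree_smul_le _ _).trans (h i j), fun i => ?_⟩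
      simp only [smul_mul_assoc, h', Matrix.smul_apply, smul_assoc, Finset.smul_sum]
  refine ⟨D, fun n x hx => ?_⟩
  induction hx using Submodule.pow_induction_on_left' with
  | algebraMap c =>
    refine ⟨Matrix.scalar _ (C c), fun i j => ?_, fun i => ?_⟩
    · by_cases h : i = j <;> simp [Matrix.scalar_apply, h]
    · rw [Finset.sum_eq_single i (fun j _ h => by simp [Matrix.scalar_apply, h.symm]) (by simp)]
      simp [Matrix.scalar_apply, Algebra.smul_def,
        IsScalarTower.algebraMap_apply k (MvPolynomial (Fin s) k) B, algebraMap_eq]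
  | add x y n _ _ hx hy => exact hadd _ x y hx hy
  | mem_mul m hm n x _ hx =>
    obtain ⟨M₁, h₁, h₁'⟩ := hspan m hm
    obtain ⟨M₂, h₂, h₂'⟩ := hx
    refine ⟨M₂ * M₁, fun i j => ?_, fun i => ?_⟩
    · rw [Matrix.mul_apply]
      refine totalDegree_finsetSum_le fun l _ => (totalDegree_mul _ _).trans ?_
      rw [Nat.succ_eq_add_one, mul_add, mul_one]
      exact add_le_add (h₂ i l) (h₁ l j)
    · rw [mul_assoc, h₂', Finset.mul_sum]
      simp only [mul_smul_comm, h₁', Finset.smul_sum, smul_smul, Matrix.mul_apply, Finset.sum_smul]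
      exact Finset.sum_comm

variable [Module.Finite (MvPolynomial (Fin s) k) B]

/-- Writing `1 = ∑ c i • ω i` gives `x = ∑ c i • (x * ω i)`, so the multiplication matrices place `W
^ n` among combinations of the `ω j` with coefficients of degree `O(n)`. -/
lemma exists_finrank_pow_le (W : Submodule k B) (hW : W.FG) :
    ∃ C : ℕ, ∀ n : ℕ, Module.finrank k (W ^ n : Submodule k B) ≤ C * (n + 1) ^ s := by
  obtain ⟨r, ω, hω⟩ := Module.Finite.exists_fin (R := MvPolynomial (Fin s) k) (M := B)
  obtain ⟨D, hD⟩ := exists_matrix_of_mem_pow hω W hW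
  obtain ⟨c, hc⟩ := (Submodule.mem_span_range_iff_exists_fun _).mp
    (hω ▸ Submodule.mem_top : (1 : B) ∈ Submodule.span (MvPolynomial (Fin s) k) (Set.range ω))
  let D₀ := Finset.univ.sup fun i => (c i).totalDegree
  have hD₀ : ∀ i, (c i).totalDegree ≤ D₀ := fun i =>
    Finset.le_sup (f := fun i => (c i).totalDegree) (Finset.mem_univ i)
  refine ⟨r * (D + D₀ + 1) ^ s, fun n => ?_⟩
  obtain ⟨hf, hr⟩ := finite_and_finrank_restrictTotalDegree_le (k := k) s (D * n + D₀)
  let φ : (Fin r → restrictTotalDegree (Fin s) k (D * n + D₀)) →ₗ[k] B :=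
    ∑ j, ((LinearMap.toSpanSingleton (MvPolynomial (Fin s) k) B (ω j)).restrictScalars k) ∘ₗ
      (Submodule.subtype _) ∘ₗ (LinearMap.proj j)
  have hφ : ∀ a, φ a = ∑ j, (a j : MvPolynomial (Fin s) k) • ω j := by
    intro a; simp [φ]
  have hle : (W ^ n : Submodule k B) ≤ LinearMap.range φ := by
    intro x hx
    obtain ⟨M, hM, hM'⟩ := hD n x hx
    refine ⟨fun j => ⟨∑ i, c i * M i j, ?_⟩, ?_⟩
    · rw [mem_restrictTotalDegree]
      refine totalDegree_finsetSum_le fun l _ => (totalDegree_mul _ _).trans ?_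
      rw [add_comm]
      exact add_le_add (hM l j) (hD₀ l)
    · rw [hφ]
      have : x = ∑ i, c i • (x * ω i) := by
        simp only [← mul_smul_comm, ← Finset.mul_sum, hc, mul_one]
      rw [this]
      simp only [hM', Finset.sum_smul, Finset.smul_sum, smul_smul]
      exact Finset.sum_comm
  calc Module.finrank k (W ^ n : Submodule k B) ≤ Module.finrank k (LinearMap.range φ) :=
        Submodule.finrank_mono hle
    _ ≤ _ := LinearMap.finrank_range_le φ
    _ ≤ r * (D * n + D₀ + 1) ^ s := by
        rw [Module.finrank_pi_fintype]; simpa using Nat.mul_le_mul_left r hr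
    _ ≤ r * ((D + D₀ + 1) * (n + 1)) ^ s := by
        gcongr; nlinarith [Nat.zero_le (D₀ * n)]
    _ = _ := by rw [mul_pow]; ring

end Filtration

/-! ### Dividing a polynomial of controlled degree. -/

section Charpoly

open MvPolynomial

/-- If the entries of `M` have degree at most `e`, so the coefficients of the characteristic
polynomial have degree at most `e * r`. -/
lemma Matrix.totalDegree_coeff_charpoly_le {k : Type*} [Field k] {s r e : ℕ}
    (M : Matrix (Fin r) (Fin r) (MvPolynomial (Fin s) k)) (hM : ∀ i j, (M i j).totalDegree ≤ e)
    (l : ℕ) : (M.charpoly.coeff l).totalDegree ≤ e * r := by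
  classical
  have hprod : ∀ (t : Finset (Fin r)) (p : Fin r → Polynomial (MvPolynomial (Fin s) k)),
      (∀ i l, ((p i).coeff l).totalDegree ≤ e) →
      ∀ l, ((∏ i ∈ t, p i).coeff l).totalDegree ≤ e * t.card := by
    intro t p hp
    induction t using Finset.induction_on with
    | empty => intro l; by_cases h : l = 0 <;> simp [Polynomial.coeff_one, h]
    | insert a t ha ih =>
      intro l
      rw [Finset.prod_insert ha, Polynomial.coeff_mul, Finset.card_insert_of_notMem ha]
      refine totalDegree_finsetSum_le fun x _ => (totalDegree_mul _ _).trans ?_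
      rw [mul_add, mul_one, add_comm]
      exact add_le_add (ih _) (hp a _)
  rw [Matrix.charpoly, Matrix.det_apply, Polynomial.finsetSum_coeff]
  refine totalDegree_finsetSum_le fun σ _ => ?_
  rw [Polynomial.coeff_smul]
  have key := hprod Finset.univ (fun i => M.charmatrix (σ i) i) (fun i l => ?_) l
  · rw [Finset.card_univ, Fintype.card_fin] at key
    rcases Int.units_eq_one_or (Equiv.Perm.sign σ) with h | h <;> simpa [h] using key
  · rw [Matrix.charmatrix_apply, Polynomial.coeff_sub, Polynomial.coeff_C]
    refine (totalDegree_sub _ _).trans (max_le ?_ ?_)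
    · rw [Matrix.diagonal_apply]
      split_ifs
      · by_cases h : l = 1 <;> simp [Polynomial.coeff_X, h, eq_comm]
      · simp
    · split_ifs
      · exact hM _ _
      · simp

variable {k : Type*} [Field k] {B : Type*} [CommRing B] [IsDomain B] [Algebra k B] {s : ℕ}
  [Algebra (MvPolynomial (Fin s) k) B] [IsScalarTower k (MvPolynomial (Fin s) k) B]
  [Module.Finite (MvPolynomial (Fin s) k) B]

/-- Nonzero elements of `W ^ n` divide nonzero polynomials of degree `O(n)`. -/
lemma exists_dvd_algebraMap_of_mem_pow (W : Submodule k B) (hW : W.FG) :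
    ∃ C : ℕ, ∀ n : ℕ, ∀ x ∈ W ^ n, x ≠ 0 → ∃ a : MvPolynomial (Fin s) k, a ≠ 0 ∧
      a.totalDegree ≤ C * n ∧ x ∣ algebraMap _ B a := by
  obtain ⟨r, ω, hω⟩ := Module.Finite.exists_fin (R := MvPolynomial (Fin s) k) (M := B)
  obtain ⟨D, hD⟩ := exists_matrix_of_mem_pow hω W hW
  refine ⟨D * r, fun n x hx hx0 => ?_⟩
  obtain ⟨M, hM, hM'⟩ := hD n x hx
  have hω0 : ω ≠ 0 := by
    rintro rfl
    have h1 : (1 : B) ∈ Submodule.span (MvPolynomial (Fin s) k) (Set.range (0 : Fin r → B)) :=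
      hω ▸ Submodule.mem_top
    obtain ⟨c, hc⟩ := (Submodule.mem_span_range_iff_exists_fun _).mp h1
    simp at hc
  have hroot : Polynomial.aeval x M.charpoly = 0 := by
    -- Cayley–Hamilton: `ω` is a nonzero null vector of `x - N`.
    let N : Matrix (Fin r) (Fin r) B := M.map (algebraMap _ B)
    have : (Matrix.scalar (Fin r) x - N).det = 0 := by
      refine Matrix.exists_mulVec_eq_zero_iff.mp ⟨ω, hω0, ?_⟩
      ext i
      rw [Matrix.sub_mulVec, Pi.sub_apply, Pi.zero_apply, sub_eq_zero]
      simp only [Matrix.scalar_apply, Matrix.mulVec_diagonal, hM']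
      simp [Matrix.mulVec, dotProduct, N, Algebra.smul_def]
    rw [← Matrix.eval_charpoly] at this
    rw [Polynomial.aeval_def, Polynomial.eval₂_eq_eval_map, ← Matrix.charpoly_map]
    exact this
  have hne : M.charpoly ≠ 0 := (Matrix.charpoly_monic M).ne_zero
  -- Stripping the powers of the variable keeps `x` a root, since `x ≠ 0` in a domain, and makes the
  -- constant coefficient nonzero. That coefficient is a multiple of `x`, and it is still a
  -- coefficient of the characteristic polynomial, so its degree is bounded.
  obtain ⟨q, hq, hq0⟩ := Polynomial.exists_eq_pow_rootMultiplicity_mul_and_not_dvd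
    M.charpoly hne 0
  rw [Polynomial.C_0, sub_zero] at hq hq0
  set m := Polynomial.rootMultiplicity 0 M.charpoly
  have hqx : Polynomial.aeval x q = 0 := by
    rw [hq, map_mul, map_pow, Polynomial.aeval_X] at hroot
    exact (mul_eq_zero.mp hroot).resolve_left (pow_ne_zero _ hx0)
  refine ⟨q.coeff 0, fun h => hq0 (Polynomial.X_dvd_iff.mpr h), ?_, ?_⟩
  · have : q.coeff 0 = M.charpoly.coeff m := by
      rw [hq]; simpa using (Polynomial.coeff_X_pow_mul q m 0).symm
    rw [this]
    refine (Matrix.totalDegree_coeff_charpoly_le M hM m).trans (le_of_eq (by ring))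
  · have h := Polynomial.divX_mul_X_add q
    rw [← h, map_add, map_mul, Polynomial.aeval_X, Polynomial.aeval_C] at hqx
    exact ⟨-(Polynomial.aeval x q.divX), by linear_combination hqx⟩

end Charpoly

/-! ### A common denominator for elements regular away from the vertex. -/

section Conductor

open MvPolynomial

lemma trdeg_eq_of_finite_injective {k S : Type u} [Field k] [CommRing S] [IsDomain S] [Algebra k S]
    {s : ℕ} (g : MvPolynomial (Fin s) k →ₐ[k] S) (hg : Function.Injective g) (hfin : g.Finite) :
    Algebra.trdeg k S = s := by
  have h : aeval (fun i : Fin s => g (X i)) = g := by ext; simp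
  have hind : AlgebraicIndependent k (fun i : Fin s => g (X i)) := by
    rw [AlgebraicIndependent, h]
    exact hg
  have hb : IsTranscendenceBasis k (fun i : Fin s => g (X i)) := by
    rw [isTranscendenceBasis_iff_algebraicIndependent_isAlgebraic]
    refine ⟨hind, ⟨fun x => IsIntegral.isAlgebraic ?_⟩⟩
    have hx : g.toRingHom.IsIntegralElem x := RingHom.Finite.to_isIntegral hfin x
    obtain ⟨p, hp, hpx⟩ := hx
    have hmem : ∀ a, g a ∈ Algebra.adjoin k (Set.range fun i : Fin s => g (X i)) := by
      intro a
      rw [Algebra.adjoin_range_eq_range_aeval]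
      exact ⟨a, congrArg (fun f => f a) h⟩
    let g' : MvPolynomial (Fin s) k →+* Algebra.adjoin k (Set.range fun i : Fin s => g (X i)) :=
      (g.codRestrict _ hmem).toRingHom
    refine ⟨p.map g', hp.map _, ?_⟩
    rw [Polynomial.eval₂_map]
    exact hpx
  have := hb.lift_cardinalMk_eq_trdeg
  simpa using this.symm

lemma MvPolynomial.X_pow_dvd_of_mul_X_pow_eq {k : Type*} [Field k] {σ : Type*} {i j : σ}
    (hij : i ≠ j) {a b : MvPolynomial σ k} {m n : ℕ} (h : a * X j ^ n = b * X i ^ m) :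
    X i ^ m ∣ a := by
  refine Prime.pow_dvd_of_dvd_mul_right X_prime m (fun hd => ?_) ⟨b, h.trans (mul_comm _ _)⟩
  exact hij ((X_dvd_X).mp ((X_prime (R := k)).dvd_of_dvd_pow hd))

/-- If `S` is a finitely generated domain of dimension at least two and `J` is an ideal with
`S / J = k`, then a single nonzero `c` multiplies into `S` all elements multiplied into `S`
by powers of the elements of `J`. -/
lemma exists_common_conductor {k S Ω : Type u} [Field k] [CommRing S] [IsDomain S] [Algebra k S]
    [Algebra.FiniteType k S] [CommRing Ω] [IsDomain Ω] [Algebra S Ω] [FaithfulSMul S Ω]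
    (J : Ideal S) (hJ : ∀ x, ∃ r : k, x - algebraMap k S r ∈ J) (h2 : 2 ≤ Algebra.trdeg k S) :
    ∃ c : S, c ≠ 0 ∧ ∀ x : Ω,
      (∀ z ∈ J, ∃ m : ℕ, ∃ t : S, algebraMap S Ω (z ^ m) * x = algebraMap S Ω t) →
      ∃ t : S, algebraMap S Ω c * x = algebraMap S Ω t := by
  classical
  obtain ⟨s, g₀, hg₀, hfin₀⟩ := exists_finite_inj_algHom_of_fg k S
  choose ρ hρ using hJ
  -- Modulo `J` each `g₀ (X i)` is a constant; translating by these constants moves all variables of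
  -- the Noether normalization into `J`.
  let τ (ε : k) : MvPolynomial (Fin s) k →ₐ[k] MvPolynomial (Fin s) k :=
    aeval fun i => X i + C (ε * ρ (g₀ (X i)))
  have hττ (ε : k) (x) : τ ε (τ (-ε) x) = x := by
    have : (τ ε).comp (τ (-ε)) = AlgHom.id k _ := by
      ext i; simp [τ]
    exact congrArg (fun f => f x) this
  let g : MvPolynomial (Fin s) k →ₐ[k] S := g₀.comp (τ (-1))
  have hgi : Function.Injective g := by
    refine hg₀.comp (Function.LeftInverse.injective (g := τ 1) (fun x => hττ 1 x))
  have hgf : g.Finite := by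
    refine hfin₀.comp (AlgHom.Finite.of_surjective _ fun x => ⟨τ 1 x, ?_⟩)
    simpa using hττ (-1) x
  have hgJ : ∀ i, g (X i) ∈ J := by
    intro i
    have : g (X i) = g₀ (X i) - algebraMap k S (ρ (g₀ (X i))) := by
      simp [g, τ, ← MvPolynomial.algebraMap_eq, sub_eq_add_neg]
    rw [this]; exact hρ _
  have hs2 : 2 ≤ s := by
    rw [trdeg_eq_of_finite_injective g hgi hgf] at h2
    exact_mod_cast h2
  let i₀ : Fin s := ⟨0, by omega⟩
  let i₁ : Fin s := ⟨1, by omega⟩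
  have hi : i₀ ≠ i₁ := by simp [i₀, i₁]
  let Z := MvPolynomial (Fin s) k
  let : Algebra Z S := g.toRingHom.toAlgebra
  have hmap : ∀ a : Z, algebraMap Z S a = g a := fun _ => rfl
  have : Module.Finite Z S := hgf
  have : FaithfulSMul Z S := (faithfulSMul_iff_algebraMap_injective Z S).mpr hgi
  let : Algebra Z Ω := ((algebraMap S Ω).comp (algebraMap Z S)).toAlgebra
  have : IsScalarTower Z S Ω := IsScalarTower.of_algebraMap_eq fun _ => rfl
  obtain ⟨r, ω, hω⟩ := Module.Finite.exists_fin (R := Z) (M := S)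
  -- A maximal independent subfamily spans a free `Z`-module `F`, and one `c ≠ 0` carries `S` into
  -- `F`. Coordinates in `F` are unique and live in a factorial ring.
  obtain ⟨T, hT, hTmax⟩ := exists_maximal_linearIndepOn Z ω
  have hmul : ∀ i, ∃ a : Z, a ≠ 0 ∧ a • ω i ∈ Submodule.span Z (ω '' T) := by
    intro i
    by_cases hi : i ∈ T
    · exact ⟨1, one_ne_zero, by
        rw [one_smul]; exact Submodule.subset_span ⟨i, hi, rfl⟩⟩
    · exact hTmax i hi
  choose a ha0 ha using hmul
  let c : Z := ∏ i, a i
  have hc0 : c ≠ 0 := Finset.prod_ne_zero_iff.mpr fun i _ => ha0 i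
  have hcω : ∀ i, c • ω i ∈ Submodule.span Z (ω '' T) := by
    intro i
    have : c = (∏ j ∈ Finset.univ.erase i, a j) * a i := by
      rw [mul_comm, Finset.mul_prod_erase _ _ (Finset.mem_univ i)]
    rw [this, mul_smul]
    exact Submodule.smul_mem _ _ (ha i)
  have hcS : ∀ x : S, c • x ∈ Submodule.span Z (ω '' T) := by
    intro x
    obtain ⟨b, rfl⟩ := (Submodule.mem_span_range_iff_exists_fun _).mp
      (hω ▸ Submodule.mem_top : x ∈ Submodule.span Z (Set.range ω))
    rw [Finset.smul_sum]
    exact Submodule.sum_mem _ fun i _ => by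
      rw [smul_comm]; exact Submodule.smul_mem _ _ (hcω i)
  have hT' : LinearIndependent Z (fun i : T => ω i) := hT
  have hrange : ω '' T = Set.range (fun i : T => ω i) := Set.image_eq_range _ _
  have : Fintype T := Fintype.ofFinite T
  have hgc0 : g c ≠ 0 := fun h => hc0 (hgi (h.trans (map_zero g).symm))
  have hinj : Function.Injective (algebraMap S Ω) := FaithfulSMul.algebraMap_injective S Ω
  refine ⟨g c, hgc0, fun x hx => ?_⟩
  -- Two variables suffice, whence the dimension hypothesis: `X i₀ ^ m * (c x)` and `X i₁ ^ n * (c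
  -- x)` have coordinates in `F`, and coprimality of the variables makes `X i₀ ^ m` divide those of
  -- the first, so `c x` comes from `F`.
  obtain ⟨m, t, ht⟩ := hx _ (hgJ i₀)
  obtain ⟨n, u, hu⟩ := hx _ (hgJ i₁)
  obtain ⟨α, hα⟩ := (Submodule.mem_span_range_iff_exists_fun Z).mp (hrange ▸ hcS t)
  obtain ⟨β, hβ⟩ := (Submodule.mem_span_range_iff_exists_fun Z).mp (hrange ▸ hcS u)
  have key : (X i₁ ^ n : Z) • (c • t) = (X i₀ ^ m : Z) • (c • u) := by
    apply hinj
    simp only [Algebra.smul_def, map_mul, hmap, map_pow] at ht hu ⊢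
    have e₀ : algebraMap (MvPolynomial (Fin s) k) S (X i₀) = g (X i₀) := rfl
    have e₁ : algebraMap (MvPolynomial (Fin s) k) S (X i₁) = g (X i₁) := rfl
    rw [← ht, ← hu, e₀, e₁]; ring
  have hαβ : ∀ i, α i * X i₁ ^ n = β i * X i₀ ^ m := by
    rw [← hα, ← hβ, Finset.smul_sum, Finset.smul_sum] at key
    simp only [smul_smul] at key
    intro i
    have := Fintype.linearIndependent_iff.mp hT'
      (fun i => X i₁ ^ n * α i - X i₀ ^ m * β i) (by
        simp only [sub_smul, Finset.sum_sub_distrib, key, sub_self]) i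
    linear_combination this
  have hdvd : ∀ i, ∃ γ, α i = X i₀ ^ m * γ := fun i =>
    MvPolynomial.X_pow_dvd_of_mul_X_pow_eq hi (hαβ i)
  choose γ hγ using hdvd
  refine ⟨∑ i, γ i • ω i, ?_⟩
  have hz0 : algebraMap S Ω (g (X i₀) ^ m) ≠ 0 := by
    rw [Ne, map_eq_zero_iff _ hinj]
    exact pow_ne_zero _ fun h => X_ne_zero i₀ (hgi (h.trans (map_zero g).symm))
  apply mul_left_cancel₀ hz0
  have h1 : g (X i₀) ^ m * ∑ i, γ i • ω i = g c * t := by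
    have : c • t = g c * t := Algebra.smul_def _ _
    rw [← this, ← hα, Finset.mul_sum]
    refine Finset.sum_congr rfl fun i _ => ?_
    rw [hγ i, Algebra.smul_def, Algebra.smul_def, hmap, hmap, map_mul, map_pow, mul_assoc]
  rw [← map_mul, h1, map_mul, ← ht]
  ring

end Conductor

/-! ### The cone over a projective variety and its saturation. -/

section Saturation

open Polynomial

variable {k K : Type u} [Field k] [Field K] [Algebra k K] {ι : Type*} (y : ι → K)

/-- The algebra generated by the forms `y i * T`. -/
noncomputable abbrev coneAlgebra (k : Type u) {K : Type u} [Field k] [Field K] [Algebra k K] {ι : Type*}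
    (y : ι → K) : Subalgebra k K[X] :=
  Algebra.adjoin k (Set.range fun i => C (y i) * X)

lemma coeff_mem_of_mem_coneAlgebra {x : K[X]} (hx : x ∈ coneAlgebra k y) (n : ℕ) :
    x.coeff n ∈ (Submodule.span k (Set.range y)) ^ n := by
  induction hx using Algebra.adjoin_induction generalizing n with
  | mem x hx =>
    obtain ⟨i, rfl⟩ := hx
    rw [coeff_C_mul, coeff_X]
    split_ifs with h
    · subst h
      rw [mul_one, pow_one]
      exact Submodule.subset_span ⟨i, rfl⟩
    · simp
  | algebraMap r =>
    rw [Polynomial.algebraMap_apply, coeff_C]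
    split_ifs with h
    · subst h
      rw [pow_zero]
      exact Submodule.algebraMap_mem r
    · simp
  | add x z _ _ hx hz => rw [coeff_add]; exact Submodule.add_mem _ (hx n) (hz n)
  | mul x z _ _ hx hz =>
    rw [coeff_mul]
    refine Submodule.sum_mem _ fun p hp => ?_
    rw [← Finset.HasAntidiagonal.mem_antidiagonal.mp hp, pow_add]
    exact Submodule.mul_mem_mul (hx _) (hz _)

lemma C_mul_X_pow_mem_coneAlgebra {n : ℕ} {x : K} (hx : x ∈ (Submodule.span k (Set.range y)) ^ n) :
    C x * X ^ n ∈ coneAlgebra k y := by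
  have hspan : ∀ x ∈ Submodule.span k (Set.range y), C x * X ∈ coneAlgebra k y := by
    intro x hx
    induction hx using Submodule.span_induction with
    | mem x hx => obtain ⟨i, rfl⟩ := hx; exact Algebra.subset_adjoin ⟨i, rfl⟩
    | zero => simp
    | add x z _ _ hx hz => rw [C_add, add_mul]; exact add_mem hx hz
    | smul c x _ hx =>
      have : C (c • x) * (X : K[X]) = c • (C x * X) := by
        rw [← smul_C, smul_mul_assoc]
      rw [this]
      exact Subalgebra.smul_mem _ hx c
  induction hx using Submodule.pow_induction_on_left' with
  | algebraMap c => simpa using Subalgebra.algebraMap_mem (coneAlgebra k y) c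
  | add x z n _ _ hx hz => rw [C_add, add_mul]; exact add_mem hx hz
  | mem_mul m hm n x _ hx =>
    have : C (m * x) * X ^ n.succ = (C m * X) * (C x * X ^ n) := by
      rw [C_mul, pow_succ]; ring
    rw [this]
    exact mul_mem (hspan m hm) hx

/-- A relation splits by total degree. In degree `n`, dividing by `x ^ n` leaves a polynomial in `z
/ x`, and the exponent `m 1` determines the monomial because `m 0 + m 1 = n`. -/
lemma algebraicIndependent_cone {x z : K} (hx : x ≠ 0) (ht : Transcendental k (z / x)) :
    AlgebraicIndependent k ![C x * X, C z * X] := by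
  rw [algebraicIndependent_iff]
  intro P hP
  have hcoeff : ∀ n, ∑ m ∈ P.support, (if m 0 + m 1 = n then
      algebraMap k K (P.coeff m) * (x ^ n * (z / x) ^ m 1) else 0) = 0 := by
    intro n
    have := congrArg (fun q => q.coeff n) hP
    simp only [MvPolynomial.aeval_def, MvPolynomial.eval₂_eq', finsetSum_coeff, Fin.prod_univ_two,
      Matrix.cons_val_zero, Matrix.cons_val_one, mul_pow, ← C_pow, coeff_zero] at this
    refine Eq.trans (Finset.sum_congr rfl fun m _ => ?_) this
    have h1 : algebraMap k K[X] (P.coeff m) * (C (x ^ m 0) * X ^ m 0 * (C (z ^ m 1) * X ^ m 1)) =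
        C (algebraMap k K (P.coeff m) * (x ^ m 0 * z ^ m 1)) * X ^ (m 0 + m 1) := by
      rw [Polynomial.algebraMap_apply, C_mul, C_mul, pow_add]; ring
    rw [h1, coeff_C_mul, coeff_X_pow]
    by_cases h : m 0 + m 1 = n
    · subst h
      simp only [if_true, mul_one]
      rw [div_pow, pow_add]
      field_simp
    · rw [if_neg h, if_neg (fun h' => h h'.symm), mul_zero]
  ext m
  rw [MvPolynomial.coeff_zero]
  by_contra hm
  let Q : k[X] := ∑ m' ∈ P.support, if m' 0 + m' 1 = m 0 + m 1 then
    monomial (m' 1) (P.coeff m') else 0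
  have hQ : aeval (z / x) Q = 0 := by
    have h := hcoeff (m 0 + m 1)
    have hxn : x ^ (m 0 + m 1) ≠ 0 := pow_ne_zero _ hx
    apply mul_left_cancel₀ hxn
    rw [mul_zero, ← h, map_sum, Finset.mul_sum]
    refine Finset.sum_congr rfl fun m' _ => ?_
    split_ifs
    · rw [aeval_monomial]; ring
    · simp
  have hQ0 : Q = 0 := by
    by_contra h
    exact ht ⟨Q, h, hQ⟩
  have h := congrArg (fun q => q.coeff (m 1)) hQ0
  simp only [Q, finsetSum_coeff, coeff_zero] at h
  rw [Finset.sum_eq_single m] at h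
  · simp [hm] at h
  · intro m' _ hne
    split_ifs with h'
    · rw [coeff_monomial, if_neg]
      intro h1
      apply hne
      ext i
      fin_cases i
      · simp only [Fin.zero_eta]; omega
      · simpa using h1
    · simp
  · intro hm'
    exact absurd (MvPolynomial.notMem_support_iff.mp hm') hm

/-- The saturation of the homogeneous coordinate ring of a projective variety of positive
dimension is contained in a fractional ideal. -/
theorem exists_mul_mem_pow_of_saturated [Finite ι] (hy : ∀ i, y i ≠ 0)
    (ht : ∃ i j, Transcendental k (y j / y i)) :
    ∃ h : K, h ≠ 0 ∧ ∃ m : ℕ, ∀ (n : ℕ) (f : K),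
      (∀ i, ∃ l, y i ^ l * f ∈ (Submodule.span k (Set.range y)) ^ (n + l)) →
      h * f ∈ (Submodule.span k (Set.range y)) ^ (n + m) := by
  set L := Submodule.span k (Set.range y) with hL
  let S := coneAlgebra k y
  have hmemY : ∀ i, C (y i) * X ∈ S := fun i => Algebra.subset_adjoin ⟨i, rfl⟩
  let Y : ι → S := fun i => ⟨C (y i) * X, hmemY i⟩
  have : Algebra.FiniteType k S :=
    (Subalgebra.fg_iff_finiteType _).mp (Subalgebra.fg_def.mpr ⟨_, Set.finite_range _, rfl⟩)
  let J : Ideal S := Ideal.span (Set.range Y)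
  have hJ : ∀ x : S, ∃ r : k, x - algebraMap k S r ∈ J := by
    rintro ⟨x, hx⟩
    induction hx using Algebra.adjoin_induction with
    | mem x hx =>
      obtain ⟨i, rfl⟩ := hx
      exact ⟨0, by simpa using Ideal.subset_span (s := Set.range Y) ⟨i, rfl⟩⟩
    | algebraMap r => exact ⟨r, by convert J.zero_mem; exact sub_self _⟩
    | add x z hx hz ihx ihz =>
      obtain ⟨r, hr⟩ := ihx
      obtain ⟨r', hr'⟩ := ihz
      refine ⟨r + r', ?_⟩
      convert J.add_mem hr hr' using 1
      have : (⟨x + z, add_mem hx hz⟩ : S) = ⟨x, hx⟩ + ⟨z, hz⟩ := rfl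
      rw [this, map_add]; ring
    | mul x z hx hz ihx ihz =>
      obtain ⟨r, hr⟩ := ihx
      obtain ⟨r', hr'⟩ := ihz
      refine ⟨r * r', ?_⟩
      convert J.add_mem (J.mul_mem_right ⟨z, hz⟩ hr) (J.mul_mem_left (algebraMap k S r) hr')
        using 1
      have : (⟨x * z, mul_mem hx hz⟩ : S) = ⟨x, hx⟩ * ⟨z, hz⟩ := rfl
      rw [this, map_mul]; ring
  have h2 : 2 ≤ Algebra.trdeg k S := by
    obtain ⟨i, j, hij⟩ := ht
    have hind : AlgebraicIndependent k ![Y i, Y j] := by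
      refine AlgebraicIndependent.of_comp S.val ?_
      have : S.val ∘ ![Y i, Y j] = ![C (y i) * X, C (y j) * X] := by
        ext l : 1
        fin_cases l <;> rfl
      rw [this]
      exact algebraicIndependent_cone (hy i) hij
    simpa using hind.lift_cardinalMk_le_trdeg
  obtain ⟨c, hc0, hc⟩ := exists_common_conductor (Ω := K[X]) J hJ h2
  have hc0' : (c : K[X]) ≠ 0 := fun h => hc0 (Subtype.ext h)
  -- The conductor `c` need not be homogeneous; the cone algebra is graded, so any one nonzero
  -- coefficient of `c` serves as `h`.
  obtain ⟨m, hm⟩ : ∃ m, (c : K[X]).coeff m ≠ 0 := by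
    by_contra! h
    exact hc0' (Polynomial.ext h)
  refine ⟨(c : K[X]).coeff m, hm, m, fun n f hf => ?_⟩
  -- The elements multiplying `f X ^ n` into `S` form an ideal. Saturation puts the generators of
  -- `J` into its radical, which gives a power of every element of `J`, as the conductor lemma
  -- requires.
  let I : Ideal S :=
    { carrier := {s | (s : K[X]) * (C f * X ^ n) ∈ S}
      add_mem' := fun {a b} ha hb => by
        simp only [Set.mem_ofPred_eq, Subalgebra.coe_add, add_mul] at *
        exact add_mem ha hb
      zero_mem' := by simp
      smul_mem' := fun a b hb => by
        simp only [Set.mem_ofPred_eq, smul_eq_mul, Subalgebra.coe_mul, mul_assoc] at *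
        exact mul_mem a.2 hb }
  have hJI : J ≤ I.radical := by
    refine Ideal.span_le.mpr ?_
    rintro _ ⟨i, rfl⟩
    obtain ⟨l, hl⟩ := hf i
    refine ⟨l, ?_⟩
    change ((Y i ^ l : S) : K[X]) * (C f * X ^ n) ∈ S
    have : ((Y i ^ l : S) : K[X]) * (C f * X ^ n) = C (y i ^ l * f) * X ^ (n + l) := by
      rw [SubmonoidClass.coe_pow, mul_pow, C_mul, C_pow, pow_add]; ring
    rw [this]
    exact C_mul_X_pow_mem_coneAlgebra y hl
  obtain ⟨t, ht⟩ := hc (C f * X ^ n) fun z hz => by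
    obtain ⟨l, hl⟩ := hJI hz
    exact ⟨l, ⟨_, hl⟩, rfl⟩
  have h := coeff_mem_of_mem_coneAlgebra y t.2 (n + m)
  have h' : (t : K[X]) = (c : K[X]) * (C f * X ^ n) := ht.symm
  rw [h', ← mul_assoc, add_comm n m, coeff_mul_X_pow, coeff_mul_C] at h
  rwa [add_comm n m]

end Saturation

/-! ### Coordinate charts, bounded poles and the upper bound on dimensions. -/

section CoordinateSystem

variable {k K : Type u} [Field k] [Field K] [Algebra k K] {ι : Type*}

/-- The coordinate ring of the chart `y i ≠ 0`. -/
noncomputable abbrev chartAlgebra (k : Type u) {K : Type u} [Field k] [Field K] [Algebra k K]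
    {ι : Type*} (y : ι → K) (i : ι) : Subalgebra k K :=
  Algebra.adjoin k (Set.range fun j => y j / y i)

/-- The family `y` is the family of nonzero homogeneous coordinates on a projective variety of
function field `K`. -/
structure IsCoordinateSystem (k : Type u) {K : Type u} [Field k] [Field K] [Algebra k K]
    {ι : Type*} (y : ι → K) : Prop where
  ne_zero : ∀ i, y i ≠ 0
  exists_div : ∀ i, ∀ x : K, ∃ a ∈ chartAlgebra k y i, ∃ b ∈ chartAlgebra k y i, b ≠ 0 ∧ x = a / b

/-- A sequence of subspaces of `K` with at most linearly growing denominators on each chart. -/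
def HasBoundedPoles (k : Type u) {K : Type u} [Field k] [Field K] [Algebra k K]
    {ι : Type*} (y : ι → K) (V : ℕ → Submodule k K) : Prop :=
  ∀ i, ∃ b ∈ chartAlgebra k y i, b ≠ 0 ∧ ∀ n, ∀ f ∈ V n, b ^ n * f ∈ chartAlgebra k y i

instance chartAlgebra_finiteType [Finite ι] (y : ι → K) (i : ι) :
    Algebra.FiniteType k (chartAlgebra k y i) :=
  (Subalgebra.fg_iff_finiteType _).mp (Subalgebra.fg_def.mpr ⟨_, Set.finite_range _, rfl⟩)

/-- The linear forms on the chart `y i ≠ 0`. -/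
noncomputable def chartForms (k : Type u) {K : Type u} [Field k] [Field K] [Algebra k K]
    {ι : Type*} (y : ι → K) (i : ι) : Submodule k (chartAlgebra k y i) :=
  Submodule.span k (Set.range fun j => ⟨y j / y i, Algebra.subset_adjoin ⟨j, rfl⟩⟩)

lemma chartForms_fg [Finite ι] (y : ι → K) (i : ι) : (chartForms k y i).FG :=
  Submodule.fg_span (Set.finite_range _)

variable {y : ι → K}

/-- Dehomogenization with respect to `y i`. -/
lemma exists_mem_chartForms_pow {i : ι} (hi : y i ≠ 0) {n : ℕ} {x : K}
    (hx : x ∈ (Submodule.span k (Set.range y)) ^ n) :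
    ∃ w ∈ (chartForms k y i) ^ n, x = y i ^ n * (w : K) := by
  induction hx using Submodule.pow_induction_on_left' with
  | algebraMap c =>
    exact ⟨algebraMap k _ c, by rw [pow_zero]; exact Submodule.algebraMap_mem c, by simp⟩
  | add x z n _ _ hx hz =>
    obtain ⟨w, hw, rfl⟩ := hx
    obtain ⟨w', hw', rfl⟩ := hz
    exact ⟨w + w', add_mem hw hw', by rw [Subalgebra.coe_add, mul_add]⟩
  | mem_mul m hm n x _ hx =>
    obtain ⟨w, hw, rfl⟩ := hx
    have : ∃ u ∈ chartForms k y i, m = y i * (u : K) := by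
      induction hm using Submodule.span_induction with
      | mem x hx =>
        obtain ⟨j, rfl⟩ := hx
        exact ⟨_, Submodule.subset_span (Set.mem_range_self j), by field_simp⟩
      | zero => exact ⟨0, zero_mem _, by simp⟩
      | add x z _ _ hx hz =>
        obtain ⟨w, hw, rfl⟩ := hx
        obtain ⟨w', hw', rfl⟩ := hz
        exact ⟨w + w', add_mem hw hw', by rw [Subalgebra.coe_add, mul_add]⟩
      | smul c x _ hx =>
        obtain ⟨w, hw, rfl⟩ := hx
        exact ⟨c • w, Submodule.smul_mem _ c hw, by
          rw [Subalgebra.coe_smul, mul_smul_comm]⟩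
    obtain ⟨u, hu, rfl⟩ := this
    refine ⟨u * w, by rw [Nat.succ_eq_add_one, pow_succ']; exact Submodule.mul_mem_mul hu hw, ?_⟩
    rw [Subalgebra.coe_mul, Nat.succ_eq_add_one, pow_succ]; ring

lemma pow_mem_span_pow (i : ι) (n : ℕ) : y i ^ n ∈ (Submodule.span k (Set.range y)) ^ n :=
  Submodule.pow_mem_pow _ (Submodule.subset_span (Set.mem_range_self i)) n

/-- Homogenization: a polynomial in the `y j / y i` becomes a form after multiplication by a power
of `y i`. -/
lemma exists_pow_mul_mem_span_pow {i : ι} (hi : y i ≠ 0) {b : K} (hb : b ∈ chartAlgebra k y i) :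
    ∃ m, y i ^ m * b ∈ (Submodule.span k (Set.range y)) ^ m := by
  induction hb using Algebra.adjoin_induction with
  | mem x hx =>
    obtain ⟨j, rfl⟩ := hx
    refine ⟨1, ?_⟩
    have : y i ^ 1 * (y j / y i) = y j := by field_simp
    rw [this, pow_one]
    exact Submodule.subset_span ⟨j, rfl⟩
  | algebraMap r => exact ⟨0, by simp⟩
  | add x z _ _ hx hz =>
    obtain ⟨m, hm⟩ := hx
    obtain ⟨n, hn⟩ := hz
    refine ⟨m + n, ?_⟩
    have : y i ^ (m + n) * (x + z) = y i ^ m * x * y i ^ n + y i ^ m * (y i ^ n * z) := by ring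
    rw [this, pow_add]
    exact add_mem (Submodule.mul_mem_mul hm (pow_mem_span_pow i n))
      (Submodule.mul_mem_mul (pow_mem_span_pow i m) hn)
  | mul x z _ _ hx hz =>
    obtain ⟨m, hm⟩ := hx
    obtain ⟨n, hn⟩ := hz
    refine ⟨m + n, ?_⟩
    have : y i ^ (m + n) * (x * z) = y i ^ m * x * (y i ^ n * z) := by ring
    rw [this, pow_add]
    exact Submodule.mul_mem_mul hm hn

namespace IsCoordinateSystem

lemma isFractionRing (hy : IsCoordinateSystem k y) (i : ι) :
    IsFractionRing (chartAlgebra k y i) K := by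
  refine IsFractionRing.of_field _ _ fun x => ?_
  obtain ⟨a, ha, b, hb, _, rfl⟩ := hy.exists_div i x
  exact ⟨⟨a, ha⟩, ⟨b, hb⟩, rfl⟩

lemma isAlgebraic (hy : IsCoordinateSystem k y) (i : ι) :
    Algebra.IsAlgebraic (chartAlgebra k y i) K := by
  have := hy.isFractionRing i
  exact IsLocalization.isAlgebraic K (nonZeroDivisors (chartAlgebra k y i))

lemma trdeg_chartAlgebra (hy : IsCoordinateSystem k y) (i : ι) :
    Algebra.trdeg k (chartAlgebra k y i) = Algebra.trdeg k K := by
  have := hy.isAlgebraic i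
  rw [← trdeg_add_eq k (chartAlgebra k y i) (A := K), trdeg_eq_zero_iff.mpr this, add_zero]

lemma exists_transcendental [Nonempty ι] (hy : IsCoordinateSystem k y)
    (h : Algebra.trdeg k K ≠ 0) : ∃ i j, Transcendental k (y j / y i) := by
  by_contra! hall
  obtain ⟨i⟩ := ‹Nonempty ι›
  apply h
  rw [← hy.trdeg_chartAlgebra i]
  have hle : chartAlgebra k y i ≤ integralClosure k K := by
    refine Algebra.adjoin_le ?_
    rintro _ ⟨j, rfl⟩
    have h := hall i j
    rw [Transcendental, not_not] at h
    exact h.isIntegral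
  have : Algebra.IsAlgebraic k (chartAlgebra k y i) := ⟨fun x => by
    have h : IsIntegral k (x : K) := hle x.2
    exact ((isIntegral_algHom_iff (chartAlgebra k y i).val Subtype.val_injective).mp h).isAlgebraic⟩
  exact trdeg_eq_zero_iff.mpr this

lemma exists_noetherNormalization [Finite ι] (hy : IsCoordinateSystem k y) (i : ι) {d : ℕ}
    (hd : Algebra.trdeg k K = d) :
    ∃ g : MvPolynomial (Fin d) k →ₐ[k] chartAlgebra k y i, Function.Injective g ∧ g.Finite := by
  obtain ⟨s, g, hg, hgf⟩ := exists_finite_inj_algHom_of_fg k (chartAlgebra k y i)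
  have : s = d := by
    have h := trdeg_eq_of_finite_injective g hg hgf
    rw [hy.trdeg_chartAlgebra, hd] at h
    exact_mod_cast h.symm
  subst this
  exact ⟨g, hg, hgf⟩

lemma exists_finrank_span_pow_le [Nonempty ι] [Finite ι] (hy : IsCoordinateSystem k y) {d : ℕ}
    (hd : Algebra.trdeg k K = d) :
    ∃ C : ℕ, ∀ n, Module.finrank k ((Submodule.span k (Set.range y)) ^ n : Submodule k K) ≤
      C * (n + 1) ^ d := by
  obtain ⟨i⟩ := ‹Nonempty ι›
  obtain ⟨g, hg, hgf⟩ := hy.exists_noetherNormalization i hd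
  let _ : Algebra (MvPolynomial (Fin d) k) (chartAlgebra k y i) := g.toRingHom.toAlgebra
  have : IsScalarTower k (MvPolynomial (Fin d) k) (chartAlgebra k y i) :=
    IsScalarTower.of_algebraMap_eq fun c => (g.commutes c).symm
  have : Module.Finite (MvPolynomial (Fin d) k) (chartAlgebra k y i) := hgf
  obtain ⟨C, hC⟩ := exists_finrank_pow_le (s := d) (chartForms k y i) (chartForms_fg y i)
  refine ⟨C, fun n => le_trans ?_ (hC n)⟩
  let φ : chartAlgebra k y i →ₗ[k] K :=
    (LinearMap.mulLeft k (y i ^ n)) ∘ₗ (chartAlgebra k y i).val.toLinearMap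
  have hle : ((Submodule.span k (Set.range y)) ^ n : Submodule k K) ≤
      ((chartForms k y i) ^ n).map φ := by
    intro x hx
    obtain ⟨w, hw, rfl⟩ := exists_mem_chartForms_pow (hy.ne_zero i) hx
    exact ⟨w, hw, rfl⟩
  have : Module.Finite k ((chartForms k y i) ^ n : Submodule k (chartAlgebra k y i)) :=
    Module.Finite.iff_fg.mpr ((chartForms_fg y i).pow n)
  exact (Submodule.finrank_mono hle).trans (Submodule.finrank_map_le _ _)

/-- A system with bounded poles embeds into forms of linearly growing degree. -/
lemma exists_mul_pow_mul_mem [Nonempty ι] [Finite ι] (hy : IsCoordinateSystem k y)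
    (hd : Algebra.trdeg k K ≠ 0) {V : ℕ → Submodule k K} (hV : HasBoundedPoles k y V) :
    ∃ h G : K, h ≠ 0 ∧ G ≠ 0 ∧ ∃ M m : ℕ, ∀ n, ∀ f ∈ V n,
      h * (G ^ n * f) ∈ (Submodule.span k (Set.range y)) ^ (M * n + m) := by
  classical
  have := Fintype.ofFinite ι
  choose b hb hb0 hbV using hV
  choose m hm using fun i => exists_pow_mul_mem_span_pow (hy.ne_zero i) (hb i)
  obtain ⟨h, hh0, e, he⟩ := exists_mul_mem_pow_of_saturated y hy.ne_zero (hy.exists_transcendental hd)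
  -- The form `s i`, of degree `m i`, clears the poles on chart `i`. The product of all of them
  -- works on every chart at once, so its `n`-th power times `f` is saturated in degree `n * ∑ m i`.
  let s : ι → K := fun i => y i ^ m i * b i
  have hs0 : ∀ i, s i ≠ 0 := fun i => mul_ne_zero (pow_ne_zero _ (hy.ne_zero i)) (hb0 i)
  refine ⟨h, ∏ i, s i, hh0, Finset.prod_ne_zero_iff.mpr fun i _ => hs0 i, ∑ i, m i, e,
    fun n f hf => he _ _ fun i => ?_⟩
  obtain ⟨l, hl⟩ := exists_pow_mul_mem_span_pow (hy.ne_zero i) (hbV i n f hf)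
  refine ⟨l, ?_⟩
  have hprod : ∏ j ∈ Finset.univ.erase i, s j ∈
      (Submodule.span k (Set.range y)) ^ (∑ j ∈ Finset.univ.erase i, m j) := by
    have : ∀ t : Finset ι, ∏ j ∈ t, s j ∈ (Submodule.span k (Set.range y)) ^ (∑ j ∈ t, m j) := by
      intro t
      induction t using Finset.induction_on with
      | empty => simp
      | insert a t ha ih =>
        rw [Finset.prod_insert ha, Finset.sum_insert ha, pow_add]
        exact Submodule.mul_mem_mul (hm a) ih
    exact this _
  have h1 : y i ^ l * ((∏ j, s j) ^ n * f) =
      (∏ j ∈ Finset.univ.erase i, s j) ^ n * (y i ^ (m i * n) * (y i ^ l * (b i ^ n * f))) := by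
    rw [← Finset.mul_prod_erase _ _ (Finset.mem_univ i)]
    simp only [s]
    rw [mul_pow, mul_pow, pow_mul]; ring
  have h2 : (∑ j, m j) * n + l = (∑ j ∈ Finset.univ.erase i, m j) * n + (m i * n + l) := by
    rw [← Finset.add_sum_erase _ _ (Finset.mem_univ i)]; ring
  rw [h1, h2, pow_add, pow_add, pow_mul]
  exact Submodule.mul_mem_mul (Submodule.pow_mem_pow _ hprod n)
    (Submodule.mul_mem_mul (pow_mem_span_pow i _) hl)

/-- Multiplication by `h * G ^ n` embeds `V n` into the forms of degree `M * n + m`. -/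
theorem finite_and_finrank_le [Nonempty ι] [Finite ι] (hy : IsCoordinateSystem k y) {d : ℕ}
    (hd : Algebra.trdeg k K = d) (hd0 : d ≠ 0) {V : ℕ → Submodule k K}
    (hV : HasBoundedPoles k y V) :
    (∀ n, Module.Finite k (V n)) ∧ ∃ C : ℕ, ∀ n, Module.finrank k (V n) ≤ C * (n + 1) ^ d := by
  obtain ⟨h, G, hh, hG, M, m, hVM⟩ := hy.exists_mul_pow_mul_mem
    (by rw [hd]; exact_mod_cast hd0) hV
  obtain ⟨C, hC⟩ := hy.exists_finrank_span_pow_le hd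
  have hfin : ∀ n, Module.Finite k ((Submodule.span k (Set.range y)) ^ n : Submodule k K) :=
    fun n => Module.Finite.iff_fg.mpr ((Submodule.fg_span (Set.finite_range _)).pow n)
  let φ : ∀ n, V n →ₗ[k] ((Submodule.span k (Set.range y)) ^ (M * n + m) : Submodule k K) :=
    fun n => LinearMap.codRestrict _ ((LinearMap.mulLeft k (h * G ^ n)) ∘ₗ (V n).subtype)
      (fun f => by simpa [mul_assoc] using hVM n f f.2)
  have hφ : ∀ n, Function.Injective (φ n) := by
    intro n a b hab
    have := congrArg Subtype.val hab
    exact Subtype.ext (mul_left_cancel₀ (mul_ne_zero hh (pow_ne_zero n hG)) this)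
  refine ⟨fun n => Module.Finite.of_injective (φ n) (hφ n), C * (M + m + 1) ^ d, fun n => ?_⟩
  calc Module.finrank k (V n) ≤ _ := LinearMap.finrank_le_finrank_of_injective (hφ n)
    _ ≤ C * (M * n + m + 1) ^ d := hC _
    _ ≤ C * ((M + m + 1) * (n + 1)) ^ d := by
        gcongr; nlinarith [Nat.zero_le (m * n)]
    _ = _ := by rw [mul_pow]; ring

end IsCoordinateSystem

end CoordinateSystem

/-! ### The lower bound on dimensions of a graded system. -/

section Growth

variable {k K : Type u} [Field k] [Field K] [Algebra k K] {ι : Type*} {y : ι → K}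

/-- Multiplying by the powers of a fixed plane preserves boundedness of the poles. -/
lemma HasBoundedPoles.mul_span_pow (hy : IsCoordinateSystem k y) {V : ℕ → Submodule k K}
    (hV : HasBoundedPoles k y V) (x : K) :
    HasBoundedPoles k y fun n => V n * (Submodule.span k {1, x}) ^ n := by
  intro i
  obtain ⟨b, hb, hb0, hbV⟩ := hV i
  obtain ⟨p, hp, q, hq, hq0, rfl⟩ := hy.exists_div i x
  refine ⟨b * q, mul_mem hb hq, mul_ne_zero hb0 hq0, fun n f hf => ?_⟩
  have h1 : ∀ z ∈ Submodule.span k {1, p / q}, q * z ∈ chartAlgebra k y i := by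
    intro z hz
    obtain ⟨α, β, rfl⟩ := Submodule.mem_span_pair.mp hz
    have : q * (α • 1 + β • (p / q)) = α • q + β • p := by
      rw [mul_add, mul_smul_comm, mul_smul_comm, mul_one, mul_div_cancel₀ _ hq0]
    rw [this]
    exact add_mem (Subalgebra.smul_mem _ hq α) (Subalgebra.smul_mem _ hp β)
  have h2 : ∀ n, ∀ z ∈ (Submodule.span k {1, p / q}) ^ n, q ^ n * z ∈ chartAlgebra k y i := by
    intro n z hz
    induction hz using Submodule.pow_induction_on_left' with
    | algebraMap c => simp
    | add z z' n _ _ hz hz' => rw [mul_add]; exact add_mem hz hz'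
    | mem_mul m hm n z _ hz =>
      have : q ^ n.succ * (m * z) = (q * m) * (q ^ n * z) := by rw [pow_succ]; ring
      rw [this]
      exact mul_mem (h1 m hm) hz
  induction hf using Submodule.mul_induction_on' with
  | mem_mul_mem f hf z hz =>
    have : (b * q) ^ n * (f * z) = (b ^ n * f) * (q ^ n * z) := by rw [mul_pow]; ring
    rw [this]
    exact mul_mem (hbV n f hf) (h2 n z hz)
  | add f _ g _ hf hg => rw [mul_add]; exact add_mem hf hg

/-- The ratios of elements of the same positive degree. -/
def ratioSet (V : ℕ → Submodule k K) : Set K :=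
  {z | ∃ n, 0 < n ∧ ∃ a ∈ V n, ∃ b ∈ V n, b ≠ 0 ∧ z = a / b}

/-- A relation `∑ c j * x ^ j = 0` with `c j ∈ V n`, divided by a fixed nonzero `b ∈ V n`, is an
algebraic equation for `x` over the ratios; so the spaces `V n * x ^ j`, `j ≤ n`, are independent.
-/
lemma finrank_mul_le_of_transcendental {V : ℕ → Submodule k K} {x : K}
    (hx : Transcendental (Algebra.adjoin k (ratioSet V)) x) {n : ℕ} (hn : 0 < n)
    [Module.Finite k (V n)]
    [Module.Finite k (V n * (Submodule.span k {1, x}) ^ n : Submodule k K)] :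
    (n + 1) * Module.finrank k (V n) ≤
      Module.finrank k (V n * (Submodule.span k {1, x}) ^ n : Submodule k K) := by
  by_cases hbot : V n = ⊥
  · rw [hbot]; simp
  obtain ⟨b, hb, hb0⟩ := Submodule.exists_mem_ne_zero_of_ne_bot hbot
  have hmem : ∀ (c : K), c ∈ V n → ∀ j : Fin (n + 1),
      c * x ^ (j : ℕ) ∈ V n * (Submodule.span k {1, x}) ^ n := by
    intro c hc j
    refine Submodule.mul_mem_mul hc ?_
    have hpow : ∀ i l, x ^ i ∈ (Submodule.span k {1, x}) ^ (i + l) := by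
      intro i l
      rw [← mul_one (x ^ i), ← one_pow l, pow_add]
      exact Submodule.mul_mem_mul (Submodule.pow_mem_pow _ (Submodule.subset_span (by simp)) _)
        (Submodule.pow_mem_pow _ (Submodule.subset_span (by simp)) _)
    have := hpow j (n - j)
    rwa [Nat.add_sub_cancel' (by omega)] at this
  let φ : (Fin (n + 1) → V n) →ₗ[k] (V n * (Submodule.span k {1, x}) ^ n : Submodule k K) :=
    LinearMap.codRestrict _
      (∑ j : Fin (n + 1), (LinearMap.mulRight k (x ^ (j : ℕ))) ∘ₗ (V n).subtype ∘ₗ (LinearMap.proj j))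
      (fun c => by
        simp only [LinearMap.coe_sum, Finset.sum_apply, LinearMap.comp_apply,
          LinearMap.mulRight_apply, Submodule.subtype_apply, LinearMap.proj_apply]
        exact Submodule.sum_mem _ fun j _ => hmem _ (c j).2 j)
  have hφ : ∀ c, (φ c : K) = ∑ j, (c j : K) * x ^ (j : ℕ) := by
    intro c
    simp [φ]
  have hinj : Function.Injective φ := by
    rw [injective_iff_map_eq_zero]
    intro c hc
    have h0 : ∑ j, (c j : K) * x ^ (j : ℕ) = 0 := by rw [← hφ, hc]; rfl
    have hA : ∀ j, (c j : K) / b ∈ Algebra.adjoin k (ratioSet V) := fun j =>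
      Algebra.subset_adjoin ⟨n, hn, _, (c j).2, b, hb, hb0, rfl⟩
    let Q : Polynomial (Algebra.adjoin k (ratioSet V)) :=
      ∑ j : Fin (n + 1), Polynomial.monomial (j : ℕ) ⟨(c j : K) / b, hA j⟩
    have hQ : Polynomial.aeval x Q = 0 := by
      simp only [Q, map_sum, Polynomial.aeval_monomial]
      have : ∀ j : Fin (n + 1), algebraMap (Algebra.adjoin k (ratioSet V)) K ⟨(c j : K) / b, hA j⟩ *
          x ^ (j : ℕ) = b⁻¹ * ((c j : K) * x ^ (j : ℕ)) := by
        intro j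
        change (c j : K) / b * _ = _
        ring
      rw [Finset.sum_congr rfl fun j _ => this j, ← Finset.mul_sum, h0, mul_zero]
    have hQ0 : Q = 0 := by
      by_contra h
      exact hx ⟨Q, h, hQ⟩
    ext j
    have h := congrArg (fun q => (q.coeff (j : ℕ) : K)) hQ0
    simp only [Q, Polynomial.finsetSum_coeff, Polynomial.coeff_monomial, Polynomial.coeff_zero]
      at h
    rw [Finset.sum_eq_single j (fun i _ hi => by rw [if_neg]; exact fun h => hi (Fin.ext h))
      (by simp)] at h
    simpa [hb0] using h
  have := LinearMap.finrank_le_finrank_of_injective hinj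
  rw [Module.finrank_pi_fintype] at this
  simpa using this

variable [Nonempty ι] [Finite ι]

/-- Adjoining a transcendental `x` would multiply the dimension by `n + 1` while keeping poles
linearly bounded, hence the dimension still `O(n ^ d)`; this contradicts `hbig`. -/
lemma isAlgebraic_adjoin_ratioSet (hy : IsCoordinateSystem k y) {d : ℕ}
    (hd : Algebra.trdeg k K = d) (hd0 : d ≠ 0) {V : ℕ → Submodule k K}
    (hV : HasBoundedPoles k y V)
    (hbig : ¬ ∃ C : ℕ, ∀ n, (n + 1) * Module.finrank k (V n) ≤ C * (n + 1) ^ d) :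
    Algebra.IsAlgebraic (Algebra.adjoin k (ratioSet V)) K := by
  refine ⟨fun x => ?_⟩
  by_contra hx
  apply hbig
  have hV' := hV.mul_span_pow hy x
  obtain ⟨hfin, -⟩ := hy.finite_and_finrank_le hd hd0 hV
  obtain ⟨hfin', C, hC⟩ := hy.finite_and_finrank_le hd hd0 hV'
  -- The second summand takes care of `n = 0`, since ratios are taken in positive degree only.
  refine ⟨C + Module.finrank k (V 0), fun n => ?_⟩
  rcases Nat.eq_zero_or_pos n with rfl | hn
  · simp
  · have := hfin n
    have := hfin' n
    refine (finrank_mul_le_of_transcendental hx hn).trans ((hC n).trans ?_)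
    gcongr
    omega

lemma prod_mem_sum {V : ℕ → Submodule k K} (hone : 1 ∈ V 0)
    (hmul : ∀ m n, ∀ a ∈ V m, ∀ b ∈ V n, a * b ∈ V (m + n)) {σ : Type*} (t : Finset σ)
    (m : σ → ℕ) (a : σ → K) (ha : ∀ i ∈ t, a i ∈ V (m i)) : ∏ i ∈ t, a i ∈ V (∑ i ∈ t, m i) := by
  classical
  induction t using Finset.induction_on with
  | empty => simpa using hone
  | insert i t hi ih =>
    rw [Finset.prod_insert hi, Finset.sum_insert hi]
    exact hmul _ _ _ (ha i (Finset.mem_insert_self i t)) _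
      (ih fun j hj => ha j (Finset.mem_insert_of_mem hj))

lemma pow_mem_mul {V : ℕ → Submodule k K} (hone : 1 ∈ V 0)
    (hmul : ∀ m n, ∀ a ∈ V m, ∀ b ∈ V n, a * b ∈ V (m + n)) {m : ℕ} {a : K} (ha : a ∈ V m)
    (r : ℕ) : a ^ r ∈ V (m * r) := by
  have := prod_mem_sum hone hmul (Finset.range r) (fun _ => m) (fun _ => a) (fun _ _ => ha)
  simpa [mul_comm] using this

/-- A graded system of maximal growth contains a polynomial ring in degrees divisible by `P`. -/
theorem exists_pow_le_finrank (hy : IsCoordinateSystem k y) {d : ℕ}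
    (hd : Algebra.trdeg k K = d) (hd0 : d ≠ 0) {V : ℕ → Submodule k K}
    (hV : HasBoundedPoles k y V) (hone : 1 ∈ V 0)
    (hmul : ∀ m n, ∀ a ∈ V m, ∀ b ∈ V n, a * b ∈ V (m + n))
    (hbig : ¬ ∃ C : ℕ, ∀ n, (n + 1) * Module.finrank k (V n) ≤ C * (n + 1) ^ d) :
    ∃ P : ℕ, 0 < P ∧ ∀ r, (r + 1) ^ d ≤ Module.finrank k (V (P * r)) := by
  classical
  have halg := isAlgebraic_adjoin_ratioSet hy hd hd0 hV hbig
  obtain ⟨hfin, -⟩ := hy.finite_and_finrank_le hd hd0 hV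
  obtain ⟨T, hT, hTb⟩ := exists_isTranscendenceBasis_subset (R := k) (ratioSet V)
  have hcard : Cardinal.mk T = d := by rw [hTb.cardinalMk_eq_trdeg, hd]
  have : Fintype T := (Cardinal.lt_aleph0_iff_fintype.mp
    (hcard ▸ Cardinal.natCast_lt_aleph0 : Cardinal.mk T < Cardinal.aleph0)).some
  have hcard' : Fintype.card T = d := by
    rw [Cardinal.mk_fintype] at hcard; exact_mod_cast hcard
  have hTne : Nonempty T := Fintype.card_pos_iff.mp (by omega)
  have hrep : ∀ z : T, ∃ n, 0 < n ∧ ∃ a ∈ V n, ∃ b ∈ V n, b ≠ 0 ∧ (z : K) = a / b :=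
    fun z => hT z.2
  choose m hm a ha b hb hb0 hz using hrep
  -- The product of the denominators puts the whole transcendence basis over one denominator `β` of
  -- degree `N`.
  let N := ∑ z, m z
  let β := ∏ z, b z
  have hβ : β ∈ V N := prod_mem_sum hone hmul _ m b fun z _ => hb z
  have hβ0 : β ≠ 0 := Finset.prod_ne_zero_iff.mpr fun z _ => hb0 z
  have hw : ∀ z : T, β * z ∈ V N := by
    intro z
    have h1 : β * z = a z * ∏ w ∈ Finset.univ.erase z, b w := by
      simp only [β]
      rw [← Finset.mul_prod_erase _ _ (Finset.mem_univ z), hz z]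
      field_simp [hb0 z]
    have h2 : N = m z + ∑ w ∈ Finset.univ.erase z, m w := by
      simp only [N]
      rw [← Finset.add_sum_erase _ _ (Finset.mem_univ z)]
    rw [h1, h2]
    exact hmul _ _ _ (ha z) _ (prod_mem_sum hone hmul _ m b fun w _ => hb w)
  have hN : 0 < N := Finset.sum_pos (fun z _ => hm z) Finset.univ_nonempty
  refine ⟨N * d, Nat.mul_pos hN (Nat.pos_of_ne_zero hd0), fun r => ?_⟩
  -- Monomials with every exponent at most `r`, padded by `β` to the common degree `N * d * r`:
  -- there are `(r + 1) ^ d` of them.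
  let e : (T → Fin (r + 1)) → K := fun α => ∏ z : T, (β ^ (r - α z) * (β * z) ^ (α z : ℕ))
  have he : ∀ α, e α ∈ V (N * d * r) := by
    intro α
    have h := prod_mem_sum hone hmul Finset.univ (fun _ : T => N * r)
      (fun z : T => β ^ (r - α z) * (β * z) ^ (α z : ℕ)) (fun z _ => by
        have h2 : N * r = N * (r - α z) + N * (α z : ℕ) := by
          rw [← mul_add, Nat.sub_add_cancel (by omega)]
        rw [h2]
        exact hmul _ _ _ (pow_mem_mul hone hmul hβ _) _ (pow_mem_mul hone hmul (hw z) _))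
    have h3 : ∑ _z : T, N * r = N * d * r := by
      rw [Finset.sum_const, Finset.card_univ, hcard', smul_eq_mul]; ring
    rwa [h3] at h
  have he' : ∀ α, e α = β ^ (r * d) * ∏ z : T, (z : K) ^ (α z : ℕ) := by
    intro α
    have : ∀ z : T, β ^ (r - α z) * (β * z) ^ (α z : ℕ) = β ^ r * (z : K) ^ (α z : ℕ) := by
      intro z
      rw [mul_pow, ← mul_assoc, ← pow_add, Nat.sub_add_cancel (by omega)]
    simp only [e]
    rw [Finset.prod_congr rfl fun z _ => this z, Finset.prod_mul_distrib, Finset.prod_const,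
      Finset.card_univ, hcard', ← pow_mul]
  have hmono : LinearIndependent k fun α : T → Fin (r + 1) => ∏ z : T, (z : K) ^ (α z : ℕ) := by
    have h1 := (MvPolynomial.basisMonomials T k).linearIndependent.map'
      (MvPolynomial.aeval (fun z : T => (z : K))).toLinearMap
      (LinearMap.ker_eq_bot.mpr hTb.1)
    have h2 := h1.comp (fun α : T → Fin (r + 1) =>
      Finsupp.equivFunOnFinite.symm fun z => (α z : ℕ)) (by
        intro α α' h
        funext z
        exact Fin.ext (congrFun (Finsupp.equivFunOnFinite.symm.injective h) z))
    have hE : ((MvPolynomial.aeval (fun z : T => (z : K))).toLinearMap ∘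
        MvPolynomial.basisMonomials T k) ∘ (fun α : T → Fin (r + 1) =>
          Finsupp.equivFunOnFinite.symm fun z => (α z : ℕ)) =
        fun α : T → Fin (r + 1) => ∏ z : T, (z : K) ^ (α z : ℕ) := by
      funext α
      simp [MvPolynomial.aeval_monomial, Finsupp.prod_fintype]
    rw [hE] at h2
    exact h2
  have hlin : LinearIndependent k e := by
    have h1 := hmono.map' (LinearMap.mulLeft k (β ^ (r * d)))
      (LinearMap.ker_eq_bot.mpr fun x x' h => mul_left_cancel₀ (pow_ne_zero _ hβ0) h)
    rw [funext he']
    exact h1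
  have hlin' : LinearIndependent k fun α => (⟨e α, he α⟩ : V (N * d * r)) :=
    LinearIndependent.of_comp (V (N * d * r)).subtype hlin
  have := hfin (N * d * r)
  have h := hlin'.fintype_card_le_finrank
  simpa [hcard'] using h

end Growth

/-! ### Linear bounds on orders of vanishing. -/

section OrderBound

variable {k K : Type u} [Field k] [Field K] [Algebra k K]

lemma map_pow_of_map_mul {v : K → ℤ} (hv : ∀ a b, a ≠ 0 → b ≠ 0 → v (a * b) = v a + v b)
    {a : K} (ha : a ≠ 0) (n : ℕ) : v (a ^ n) = n * v a := by
  induction n with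
  | zero =>
    have := hv 1 1 one_ne_zero one_ne_zero
    rw [mul_one] at this
    simp only [pow_zero, Nat.cast_zero, zero_mul]
    omega
  | succ n ih => rw [pow_succ, hv _ _ (pow_ne_zero _ ha) ha, ih]; push_cast; ring

/-- The order along a height-one prime of a finite extension is linearly bounded on
polynomials. -/
lemma exists_order_le_totalDegree {d : ℕ} {B : Subalgebra k K}
    (g : MvPolynomial (Fin d) k →ₐ[k] B) (hg : Function.Injective g) (hgf : g.Finite)
    {v : K → ℤ} (hv : ∀ a b, a ≠ 0 → b ≠ 0 → v (a * b) = v a + v b)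
    (p : Ideal B) [p.IsPrime] (hp : p.height = 1)
    (h0 : ∀ x : B, x ≠ 0 → 0 ≤ v x) (hpos : ∀ x : B, x ≠ 0 → x ∉ p → v x = 0) :
    ∃ C : ℕ, ∀ a : MvPolynomial (Fin d) k, a ≠ 0 → v (g a) ≤ C * a.totalDegree := by
  classical
  let _ : Algebra (MvPolynomial (Fin d) k) B := g.toRingHom.toAlgebra
  have : Module.Finite (MvPolynomial (Fin d) k) B := hgf
  have : FaithfulSMul (MvPolynomial (Fin d) k) B := (faithfulSMul_iff_algebraMap_injective _ _).mpr hg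
  have hne : ∀ a, a ≠ 0 → g a ≠ 0 := fun a ha h => ha (hg (h.trans (map_zero g).symm))
  have hneK : ∀ a, a ≠ 0 → (g a : K) ≠ 0 := fun a ha h => hne a ha (Subtype.ext h)
  -- Going down over the normal polynomial ring gives `q` height at most one; if nonzero it is
  -- principal by factoriality. If `q` is zero, every nonzero polynomial has order zero.
  let q : Ideal (MvPolynomial (Fin d) k) := p.under _
  have hmem : ∀ a, a ∈ q ↔ g a ∈ p := fun a => Iff.rfl
  have : IsNoetherianRing B := IsNoetherianRing.of_finite (MvPolynomial (Fin d) k) B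
  have hheight : q.height ≤ 1 := by
    have h := Ideal.height_eq_height_add_of_liesOver_of_hasGoingDown q p
    rw [hp] at h
    rw [h]
    exact le_self_add
  by_cases hq : q = ⊥
  · refine ⟨0, fun a ha => ?_⟩
    rw [hpos _ (hne a ha) (fun h => ?_)]
    · simp
    · rw [← hmem, hq] at h
      exact ha h
  have hq1 : q.height = 1 := by
    refine le_antisymm hheight ?_
    rw [Order.one_le_iff_ne_zero]
    exact fun h => hq (Ideal.height_eq_zero_iff_eq_bot.mp h)
  obtain ⟨π, hπ⟩ := (UniqueFactorizationMonoid.isPrincipal_of_height_eq_one hq1).principal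
  have hπ0 : π ≠ 0 := by rintro rfl; exact hq (by rw [hπ]; simp)
  have hπp : Prime π := (Ideal.span_singleton_prime hπ0).mp (by
    have : q.IsPrime := inferInstance
    rwa [hπ] at this)
  have hdeg : 1 ≤ π.totalDegree := by
    by_contra! h
    have h' := MvPolynomial.totalDegree_eq_zero_iff_eq_C.mp (Nat.lt_one_iff.mp h)
    refine hπp.not_isUnit ?_
    rw [h'] at hπ0 ⊢
    exact (IsUnit.mk0 _ fun h => hπ0 (by rw [h, MvPolynomial.C_0])).map MvPolynomial.C
  refine ⟨(v (g π)).toNat, fun a ha => ?_⟩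
  -- The cofactor `b` lies outside `q` and has order zero, so the order is `r * v (g π)`; and `r` is
  -- at most the degree because `π` is not constant.
  obtain ⟨r, b, hb, rfl⟩ := WfDvdMonoid.max_power_factor ha hπp.irreducible
  have hb0 : b ≠ 0 := by rintro rfl; simp at hb
  have hbq : g b ∉ p := by
    rw [← hmem, hπ]
    exact fun h => hb (Ideal.mem_span_singleton.mp h)
  have h1 : v (g (π ^ r * b)) = r * v (g π) := by
    rw [map_mul, map_pow, MulMemClass.coe_mul, SubmonoidClass.coe_pow,
      hv _ _ (pow_ne_zero _ (hneK π hπ0)) (hneK b hb0), map_pow_of_map_mul hv (hneK π hπ0),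
      hpos _ (hne b hb0) hbq, add_zero]
  have h2 : r ≤ (π ^ r * b).totalDegree := by
    rw [MvPolynomial.totalDegree_mul_of_isDomain (pow_ne_zero _ hπ0) hb0]
    have : ∀ r : ℕ, (π ^ r).totalDegree = r * π.totalDegree := by
      intro r
      induction r with
      | zero => simp
      | succ r ih =>
        rw [pow_succ, MvPolynomial.totalDegree_mul_of_isDomain (pow_ne_zero _ hπ0) hπ0, ih]; ring
    rw [this]
    nlinarith
  have h3 : 0 ≤ v (g π) := h0 _ (hne π hπ0)
  rw [h1, Int.toNat_of_nonneg h3, mul_comm]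
  exact mul_le_mul_of_nonneg_left (by exact_mod_cast h2) h3

variable {ι : Type*} {y : ι → K} [Nonempty ι] [Finite ι]

/-- The order of vanishing along a prime divisor is linearly bounded on a system with bounded
poles. -/
theorem exists_order_le (hy : IsCoordinateSystem k y) {d : ℕ}
    (hd : Algebra.trdeg k K = d) (hd0 : d ≠ 0) {V : ℕ → Submodule k K}
    (hV : HasBoundedPoles k y V) {v : K → ℤ}
    (hv : ∀ a b, a ≠ 0 → b ≠ 0 → v (a * b) = v a + v b) (i : ι)
    (p : Ideal (chartAlgebra k y i)) [p.IsPrime] (hp : p.height = 1)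
    (h0 : ∀ x : chartAlgebra k y i, x ≠ 0 → 0 ≤ v x)
    (hpos : ∀ x : chartAlgebra k y i, x ≠ 0 → x ∉ p → v x = 0) :
    ∃ C : ℕ, ∀ n, ∀ f ∈ V n, f ≠ 0 → v f ≤ C * (n + 1) := by
  obtain ⟨g, hg, hgf⟩ := hy.exists_noetherNormalization i hd
  obtain ⟨C₁, hC₁⟩ := exists_order_le_totalDegree g hg hgf hv p hp h0 hpos
  let _ : Algebra (MvPolynomial (Fin d) k) (chartAlgebra k y i) := g.toRingHom.toAlgebra
  have : IsScalarTower k (MvPolynomial (Fin d) k) (chartAlgebra k y i) :=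
    IsScalarTower.of_algebraMap_eq fun c => (g.commutes c).symm
  have : Module.Finite (MvPolynomial (Fin d) k) (chartAlgebra k y i) := hgf
  obtain ⟨C₂, hC₂⟩ := exists_dvd_algebraMap_of_mem_pow (s := d) (chartForms k y i)
    (chartForms_fg y i)
  obtain ⟨h, G, hh, hG, M, m, hVM⟩ := hy.exists_mul_pow_mul_mem
    (by rw [hd]; exact_mod_cast hd0) hV
  have hyi := hy.ne_zero i
  refine ⟨(M + m) * ((v (y i)).natAbs + C₁ * C₂) + (v h).natAbs + (v G).natAbs,
    fun n f hf hf0 => ?_⟩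
  -- Up to fixed factors `h`, `G ^ n` and a power of `y i`, the function `f` is `w`. It divides a
  -- polynomial of degree `O(n)` with a cofactor of nonnegative order, so `v w` is at most the order
  -- of that polynomial.
  obtain ⟨w, hw, hfw⟩ := exists_mem_chartForms_pow hyi (hVM n f hf)
  have hw0 : w ≠ 0 := by
    rintro rfl
    rw [ZeroMemClass.coe_zero, mul_zero] at hfw
    exact mul_ne_zero hh (mul_ne_zero (pow_ne_zero n hG) hf0) hfw
  have hw0' : (w : K) ≠ 0 := fun h => hw0 (Subtype.ext h)
  obtain ⟨a, ha0, had, c, hc⟩ := hC₂ _ w hw hw0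
  have hga : g a ≠ 0 := fun h => ha0 (hg (h.trans (map_zero g).symm))
  have hc' : g a = w * c := hc
  have hc0 : c ≠ 0 := by rintro rfl; rw [mul_zero] at hc'; exact hga hc'
  have hvw : v w ≤ C₁ * (C₂ * (M * n + m)) := by
    have h1 : v (g a) = v w + v c := by
      rw [hc', MulMemClass.coe_mul, hv _ _ hw0' fun h => hc0 (Subtype.ext h)]
    have h2 := h0 c hc0
    have h3 := hC₁ a ha0
    have h4 : (C₁ : ℤ) * a.totalDegree ≤ C₁ * (C₂ * (M * n + m)) := by
      gcongr
      exact_mod_cast had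
    linarith
  have heq : v h + (n * v G + v f) = (M * n + m : ℕ) * v (y i) + v w := by
    rw [← map_pow_of_map_mul hv hG, ← hv _ _ (pow_ne_zero n hG) hf0,
      ← hv _ _ hh (mul_ne_zero (pow_ne_zero n hG) hf0), hfw, hv _ _ (pow_ne_zero _ hyi) hw0',
      map_pow_of_map_mul hv hyi]
  have b1 : v (y i) ≤ (v (y i)).natAbs := Int.le_natAbs
  have b2 : -v h ≤ (v h).natAbs := by omega
  have b3 : -v G ≤ (v G).natAbs := by omega
  push_cast at heq ⊢
  set A : ℤ := |v (y i)| with hA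
  have hMn : (0 : ℤ) ≤ M * n + m := by positivity
  have hle : (M * n + m : ℤ) ≤ (M + m) * (n + 1) := by
    have : (0 : ℤ) ≤ m * n := by positivity
    nlinarith
  have t1 : (M * n + m : ℤ) * v (y i) ≤ (M + m) * (n + 1) * A :=
    (mul_le_mul_of_nonneg_left (le_abs_self _) hMn).trans
      (mul_le_mul_of_nonneg_right hle (abs_nonneg _))
  have t2 : (C₁ : ℤ) * (C₂ * (M * n + m)) ≤ (M + m) * (n + 1) * (C₁ * C₂) := by
    have : (0 : ℤ) ≤ C₁ * C₂ := by positivity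
    nlinarith [mul_le_mul_of_nonneg_right hle this]
  have t3 : -v h ≤ |v h| * (n + 1) := by
    have : -v h ≤ |v h| := neg_le_abs _
    nlinarith [abs_nonneg (v h), mul_nonneg (abs_nonneg (v h)) (Int.natCast_nonneg n)]
  have t4 : -(n * v G) ≤ |v G| * (n + 1) := by
    have : -v G ≤ |v G| := neg_le_abs _
    nlinarith [abs_nonneg (v G), mul_le_mul_of_nonneg_left this (Int.natCast_nonneg n)]
  nlinarith

end OrderBound

/-! ### The gap created by an excess pole. -/

section Gap

variable {k K : Type u} [Field k] [Field K] [Algebra k K]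

/-- Nonzero degrees of a sequence of subspaces have bounded minimal representatives modulo `M`. -/
lemma exists_bounded_representative (V : ℕ → Submodule k K) (M : ℕ) (hM : 0 < M) :
    ∃ R₀ : ℕ, ∀ n, V n ≠ ⊥ → ∃ n' ≤ R₀, ∃ q, n = n' + M * q ∧ V n' ≠ ⊥ := by
  classical
  let e : ℕ → ℕ := fun ρ => if h : ∃ n, V n ≠ ⊥ ∧ n % M = ρ then Nat.find h else 0
  refine ⟨(Finset.range M).sup e, fun n hn => ?_⟩
  have h : ∃ n', V n' ≠ ⊥ ∧ n' % M = n % M := ⟨n, hn, rfl⟩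
  have he : e (n % M) = Nat.find h := dif_pos h
  obtain ⟨h1, h2⟩ := Nat.find_spec h
  have h3 : Nat.find h ≤ n := Nat.find_min' h ⟨hn, rfl⟩
  refine ⟨Nat.find h, he ▸ Finset.le_sup (Finset.mem_range.mpr (Nat.mod_lt n hM)),
    (n - Nat.find h) / M, ?_, h1⟩
  have := (Nat.modEq_iff_dvd' h3).mp h2
  rw [Nat.mul_div_cancel' this]
  omega

lemma finrank_le_of_mul_mem {V W : Submodule k K} [Module.Finite k W] {a : K} (ha : a ≠ 0)
    (h : ∀ f ∈ V, a * f ∈ W) : Module.finrank k V ≤ Module.finrank k W := by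
  refine LinearMap.finrank_le_finrank_of_injective
    (f := ((LinearMap.mulLeft k a) ∘ₗ V.subtype).codRestrict W fun f => h f f.2) ?_
  intro x z hxz
  exact Subtype.ext (mul_left_cancel₀ ha (congrArg Subtype.val hxz))

/-- The hypothesis `h'` makes the sum of `V` and `a * V'` direct inside `W`. -/
lemma finrank_add_finrank_le {V V' W : Submodule k K} [Module.Finite k W] {a : K} (ha : a ≠ 0)
    (hVW : V ≤ W) (h : ∀ f ∈ V', a * f ∈ W) (h' : ∀ f ∈ V', f ≠ 0 → a * f ∉ V) :
    Module.finrank k V + Module.finrank k V' ≤ Module.finrank k W := by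
  let U := V'.map (LinearMap.mulLeft k a)
  have hU : U ≤ W := by
    rintro _ ⟨f, hf, rfl⟩
    exact h f hf
  have : Module.Finite k V := Module.Finite.of_injective _ (Submodule.inclusion_injective hVW)
  have : Module.Finite k U := Module.Finite.of_injective _ (Submodule.inclusion_injective hU)
  have hinf : V ⊓ U = ⊥ := by
    rw [eq_bot_iff]
    rintro _ ⟨hx, f, hf, rfl⟩
    by_contra hne
    refine h' f hf (fun h0 => hne ?_) hx
    rw [h0, map_zero]; exact zero_mem _
  have h1 := Submodule.finrank_sup_add_finrank_inf_eq V U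
  rw [hinf, finrank_bot, add_zero] at h1
  have h2 : Module.finrank k V' ≤ Module.finrank k U :=
    finrank_le_of_mul_mem ha fun f hf => ⟨f, hf, rfl⟩
  have h3 : Module.finrank k (V ⊔ U : Submodule k K) ≤ Module.finrank k W :=
    Submodule.finrank_mono (sup_le hVW hU)
  omega

/-- If `W` contains a function with a pole along a prime divisor which is larger than allowed
in `V`, then the dimensions of `W` exceed those of `V` by a positive fraction of `n ^ d`. -/
theorem exists_finrank_add_le {V W : ℕ → Submodule k K} {d : ℕ}
    (hVW : ∀ n, V n ≤ W n) (hfin : ∀ n, Module.Finite k (W n))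
    (honeW : 1 ∈ W 0)
    (hmul : ∀ m n, ∀ a ∈ V m, ∀ b ∈ V n, a * b ∈ V (m + n))
    (hmulW : ∀ m n, ∀ a ∈ W m, ∀ b ∈ W n, a * b ∈ W (m + n))
    {v : K → ℤ} (hv : ∀ a b, a ≠ 0 → b ≠ 0 → v (a * b) = v a + v b)
    {a : ℝ} (ha : ∀ n, ∀ f ∈ V n, f ≠ 0 → -(n * a) ≤ v f)
    {C : ℕ} (hC : ∀ n, ∀ f ∈ V n, f ≠ 0 → v f ≤ C * (n + 1))
    {m : ℕ} (hm : 0 < m) {f : K} (hf0 : f ≠ 0) (hf : f ∈ W m) (hvf : (v f : ℝ) < -(m * a))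
    {P : ℕ} (hP : 0 < P) (hgrow : ∀ r, (r + 1) ^ d ≤ Module.finrank k (V (P * r))) :
    ∃ R n₀ : ℕ, 0 < R ∧ ∀ n ≥ n₀, V n ≠ ⊥ →
      Module.finrank k (V n) + (n / R + 1) ^ d ≤ Module.finrank k (W n) := by
  have hfinV : ∀ n, Module.Finite k (V n) := fun n =>
    have := hfin n
    Module.Finite.of_injective _ (Submodule.inclusion_injective (hVW n))
  set δ : ℝ := -(m * a) - v f with hδ
  have hδ0 : 0 < δ := by linarith
  -- With `j ≥ C' (l + 1)` the excess `j δ` outweighs both the possible zeros, at most `C (l + 1)`,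
  -- and the discrepancy `l * a`.
  obtain ⟨C', hC'⟩ := exists_nat_gt ((C + |a|) / δ)
  rw [div_lt_iff₀ hδ0] at hC'
  have hM : 0 < m * P := Nat.mul_pos hm hP
  obtain ⟨R₀, hR₀⟩ := exists_bounded_representative V (m * P) hM
  -- Then `Q (l + 1) ≤ n = m j + l` forces `j ≥ C' (l + 1)`. In the next line, the factor `2`
  -- reserves one half of `n` for the bounded part `n' + 1` of `l + 1` and one half for `m P r`.
  set Q := m * C' + 1 with hQ
  refine ⟨2 * Q * (m * P), 2 * Q * (R₀ + 1), by positivity, fun n hn hVn => ?_⟩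
  obtain ⟨n', hn', q, hq, hVn'⟩ := hR₀ n hVn
  set r := n / (2 * Q * (m * P)) with hr
  have hrn : 2 * Q * (m * P) * r ≤ n := Nat.mul_div_le n _
  have hl : Q * (n' + m * P * r + 1) ≤ n := by
    have h1 : 2 * (Q * (n' + 1)) ≤ n := by
      refine le_trans ?_ hn
      rw [mul_assoc]
      exact Nat.mul_le_mul_left 2 (Nat.mul_le_mul_left Q (by omega))
    have h2 : 2 * (Q * (m * P * r)) ≤ n := by
      refine le_trans (le_of_eq ?_) hrn
      ring
    have h3 : Q * (n' + m * P * r + 1) = Q * (n' + 1) + Q * (m * P * r) := by ring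
    omega
  -- This degree is congruent to `n` modulo `m`, so `n - l` is filled by powers of `f`; and a
  -- nonzero element of `V n'` multiplies `V (P * (m * r))` into `V l`, so `V l` is large.
  set l := n' + m * P * r with hldef
  have hln : l ≤ n := by nlinarith [Nat.zero_le (m * C')]
  have hrq : r ≤ q := by
    have h1 : m * P * r ≤ m * P * q := by omega
    exact Nat.le_of_mul_le_mul_left h1 hM
  let j := P * (q - r)
  have hnj : n = m * j + l := by
    simp only [j, hldef]
    have : m * (P * (q - r)) = m * P * q - m * P * r := by
      rw [← mul_assoc, Nat.mul_sub]
    have h1 : m * P * r ≤ m * P * q := Nat.mul_le_mul_left _ hrq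
    omega
  have hj : C' * (l + 1) ≤ j := by
    have h1 : m * (C' * (l + 1)) ≤ m * j := by
      have : Q * (l + 1) = m * (C' * (l + 1)) + (l + 1) := by rw [hQ]; ring
      omega
    exact Nat.le_of_mul_le_mul_left h1 hm
  have hVl : (r + 1) ^ d ≤ Module.finrank k (V l) := by
    obtain ⟨b, hb, hb0⟩ := Submodule.exists_mem_ne_zero_of_ne_bot hVn'
    have := hfinV l
    have h1 : Module.finrank k (V (P * (m * r))) ≤ Module.finrank k (V l) :=
      finrank_le_of_mul_mem hb0 fun g hg => by
        have := hmul _ _ b hb g hg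
        have h2 : n' + P * (m * r) = l := by rw [hldef]; ring
        rwa [h2] at this
    refine le_trans (Nat.pow_le_pow_left ?_ d) ((hgrow (m * r)).trans h1)
    nlinarith
  have := hfin n
  have key := finrank_add_finrank_le (V := V n) (V' := V l) (W := W n) (pow_ne_zero j hf0)
    (hVW n) (fun g hg => by
      rw [hnj]
      exact hmulW _ _ _ (pow_mem_mul honeW hmulW hf j) _ (hVW l hg))
    (fun g hg hg0 hmem => by
      have h1 := ha n _ hmem (mul_ne_zero (pow_ne_zero j hf0) hg0)
      rw [hv _ _ (pow_ne_zero j hf0) hg0, map_pow_of_map_mul hv hf0, hnj] at h1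
      have h2 : (v g : ℝ) ≤ C * (l + 1) := by exact_mod_cast hC l g hg hg0
      have h3 : ((C' * (l + 1) : ℕ) : ℝ) ≤ j := by exact_mod_cast hj
      push_cast at h1 h3
      have h4 : (v f : ℝ) = -(m * a) - δ := by rw [hδ]; ring
      rw [h4] at h1
      have h5 : (C + |a|) * (l + 1) < C' * δ * (l + 1) :=
        mul_lt_mul_of_pos_right hC' (by positivity)
      have h6 : (C' * (l + 1)) * δ ≤ j * δ := mul_le_mul_of_nonneg_right h3 hδ0.le
      have h7 : (l : ℝ) * a ≤ l * |a| := mul_le_mul_of_nonneg_left (le_abs_self a) (by positivity)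
      have h8 := abs_nonneg a
      nlinarith)
  omega

end Gap

/-! ### From dimension gaps to volume gaps. -/

section Limsup

open Filter

lemma natCast_div_pow_div_factorial_eq (a d : ℕ) {n : ℕ} (hn : 0 < n) :
    (a : ENNReal) / ((n : ENNReal) ^ d / (d.factorial : ENNReal)) =
      ENNReal.ofReal (a * d.factorial / (n : ℝ) ^ d) := by
  have h1 : (0 : ℝ) < d.factorial := by exact_mod_cast d.factorial_pos
  have h2 : (0 : ℝ) < (n : ℝ) ^ d := by positivity
  have h3 : (a * d.factorial / (n : ℝ) ^ d) = a / ((n : ℝ) ^ d / d.factorial) := by field_simp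
  rw [h3, ENNReal.ofReal_div_of_pos (by positivity), ENNReal.ofReal_div_of_pos h1,
    ENNReal.ofReal_natCast, ENNReal.ofReal_natCast, ENNReal.ofReal_pow (by positivity),
    ENNReal.ofReal_natCast]

lemma succ_pow_le_two_mul_pow (d : ℕ) {n : ℕ} (hn : 0 < n) :
    ((n : ℝ) + 1) ^ d ≤ 2 ^ d * (n : ℝ) ^ d := by
  rw [← mul_pow]
  have : (1 : ℝ) ≤ n := by exact_mod_cast hn
  exact pow_le_pow_left₀ (by positivity) (by linarith) d

/-- Sequences of order `o(n ^ d)` have volume zero. -/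
lemma not_exists_bound_of_limsup_pos {a : ℕ → ℕ} {d : ℕ}
    (hpos : 0 < limsup (fun n : ℕ => (a n : ENNReal) /
      ((n : ENNReal) ^ d / (d.factorial : ENNReal))) atTop) :
    ¬ ∃ C : ℕ, ∀ n, (n + 1) * a n ≤ C * (n + 1) ^ d := by
  rintro ⟨C, hC⟩
  refine hpos.ne' ?_
  refine Tendsto.limsup_eq ?_
  have h0 : Tendsto (fun n : ℕ => ENNReal.ofReal (C * 2 ^ d * d.factorial * (n : ℝ)⁻¹)) atTop
      (nhds 0) := by
    rw [← ENNReal.ofReal_zero]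
    refine ENNReal.tendsto_ofReal ?_
    simpa using (tendsto_inv_atTop_nhds_zero_nat (𝕜 := ℝ)).const_mul (C * 2 ^ d * d.factorial : ℝ)
  refine tendsto_of_tendsto_of_tendsto_of_le_of_le' tendsto_const_nhds h0
    (Eventually.of_forall fun _ => zero_le) ?_
  filter_upwards [eventually_ge_atTop 1] with n hn
  rw [natCast_div_pow_div_factorial_eq _ _ hn]
  refine ENNReal.ofReal_le_ofReal ?_
  have hn' : (0 : ℝ) < n := by exact_mod_cast hn
  have h1 : ((n : ℝ) + 1) * a n ≤ C * ((n : ℝ) + 1) ^ d := by exact_mod_cast hC n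
  have h2 := succ_pow_le_two_mul_pow d hn
  have h3 : (n : ℝ) * a n ≤ C * (2 ^ d * (n : ℝ) ^ d) := by
    have := mul_le_mul_of_nonneg_left h2 (Nat.cast_nonneg (α := ℝ) C)
    nlinarith [Nat.cast_nonneg (α := ℝ) (a n)]
  rw [div_le_iff₀ (by positivity)]
  have h4 : (C * 2 ^ d * d.factorial * (n : ℝ)⁻¹) * (n : ℝ) ^ d =
      (C * (2 ^ d * (n : ℝ) ^ d)) * d.factorial / n := by field_simp
  rw [h4, le_div_iff₀ hn']
  nlinarith [Nat.cast_nonneg (α := ℝ) d.factorial]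

/-- Let `L` be the first limsup. Terms above `L - ε` occur infinitely often and are nonzero, so
there the increment, at least `c = d! / R ^ d` after normalization, is available. With `ε = c / 2`
the second limsup is at least `L - ε + c > L`; finiteness of `L`, from `haC`, makes this strict. -/
lemma limsup_lt_limsup_of_add_le {a b : ℕ → ℕ} {d C R n₀ : ℕ} (hR : 0 < R)
    (haC : ∀ n, a n ≤ C * (n + 1) ^ d)
    (hab : ∀ n ≥ n₀, a n ≠ 0 → a n + (n / R + 1) ^ d ≤ b n)
    (hpos : 0 < limsup (fun n : ℕ => (a n : ENNReal) /
      ((n : ENNReal) ^ d / (d.factorial : ENNReal))) atTop) :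
    limsup (fun n : ℕ => (a n : ENNReal) / ((n : ENNReal) ^ d / (d.factorial : ENNReal))) atTop <
    limsup (fun n : ℕ => (b n : ENNReal) / ((n : ENNReal) ^ d / (d.factorial : ENNReal))) atTop := by
  set u := fun n : ℕ => (a n : ENNReal) / ((n : ENNReal) ^ d / (d.factorial : ENNReal))
  set w := fun n : ℕ => (b n : ENNReal) / ((n : ENNReal) ^ d / (d.factorial : ENNReal))
  have hR' : (0 : ℝ) < R := by exact_mod_cast hR
  have hfact : (0 : ℝ) < d.factorial := by exact_mod_cast d.factorial_pos
  let c : ℝ := d.factorial / (R : ℝ) ^ d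
  have hc : 0 < c := by positivity
  have huw : ∀ᶠ n in atTop, u n ≠ 0 → u n + ENNReal.ofReal c ≤ w n := by
    filter_upwards [eventually_ge_atTop 1, eventually_ge_atTop n₀] with n hn hn₀ hun
    have han : a n ≠ 0 := fun h => hun (by simp [u, h])
    have hn' : (0 : ℝ) < n := by exact_mod_cast hn
    simp only [u, w]
    rw [natCast_div_pow_div_factorial_eq _ _ hn, natCast_div_pow_div_factorial_eq _ _ hn,
      ← ENNReal.ofReal_add (by positivity) hc.le]
    refine ENNReal.ofReal_le_ofReal ?_
    have h1 : (a n : ℝ) + ((n / R : ℕ) + 1 : ℝ) ^ d ≤ b n := by exact_mod_cast hab n hn₀ han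
    have h2 : (n : ℝ) / R ≤ (n / R : ℕ) + 1 := by
      rw [div_le_iff₀ hR']
      have := (Nat.lt_div_mul_add (a := n) hR).le
      have h3 : (n : ℝ) ≤ (n / R : ℕ) * R + R := by exact_mod_cast this
      linarith
    have h3 : ((n : ℝ) / R) ^ d ≤ ((n / R : ℕ) + 1 : ℝ) ^ d :=
      pow_le_pow_left₀ (by positivity) h2 d
    have h4 : c = ((n : ℝ) / R) ^ d * d.factorial / (n : ℝ) ^ d := by
      simp only [c]; rw [div_pow]; field_simp
    rw [h4, ← add_div, ← add_mul]
    gcongr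
    linarith
  have hfin : limsup u atTop ≠ ⊤ := by
    refine ne_top_of_le_ne_top (ENNReal.ofReal_ne_top (r := C * 2 ^ d * d.factorial)) ?_
    refine limsup_le_of_le (by isBoundedDefault) ?_
    filter_upwards [eventually_ge_atTop 1] with n hn
    simp only [u]
    rw [natCast_div_pow_div_factorial_eq _ _ hn]
    refine ENNReal.ofReal_le_ofReal ?_
    have hn' : (0 : ℝ) < n := by exact_mod_cast hn
    rw [div_le_iff₀ (by positivity)]
    have h1 : (a n : ℝ) ≤ C * ((n : ℝ) + 1) ^ d := by exact_mod_cast haC n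
    have h2 := mul_le_mul_of_nonneg_left (succ_pow_le_two_mul_pow d hn) (Nat.cast_nonneg (α := ℝ) C)
    nlinarith
  set L := limsup u atTop
  let ε : ENNReal := ENNReal.ofReal (c / 2)
  have hε : 0 < ε := ENNReal.ofReal_pos.mpr (by positivity)
  have hεc : ε < ENNReal.ofReal c := (ENNReal.ofReal_lt_ofReal_iff hc).mpr (by linarith)
  have hL' : L - ε < L := ENNReal.sub_lt_self hfin hpos.ne' hε.ne'
  have h1 : ∃ᶠ n in atTop, L - ε < u n := frequently_lt_of_lt_limsup (by isBoundedDefault) hL'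
  have h2 : ∃ᶠ n in atTop, L - ε + ENNReal.ofReal c ≤ w n := by
    refine (h1.and_eventually huw).mono fun n hn => ?_
    exact (add_le_add_left hn.1.le _).trans (hn.2 (ne_bot_of_gt hn.1))
  have h3 := le_limsup_of_frequently_le h2 (by isBoundedDefault)
  refine lt_of_lt_of_le ?_ h3
  calc L ≤ L - ε + ε := le_tsub_add
    _ < L - ε + ENNReal.ofReal c :=
      ENNReal.add_lt_add_left (ne_top_of_le_ne_top hfin tsub_le_self) hεc

end Limsup

/-! ### Algebraic Hartogs lemma. -/

section Hartogs

variable {R K : Type*} [CommRing R] [IsDomain R] [IsNoetherianRing R] [IsIntegrallyClosed R]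
  [Field K] [Algebra R K] [IsFractionRing R K]

/-- A normal noetherian domain is the intersection of its localizations at height-one primes. -/
theorem mem_range_algebraMap_of_height_one (x : K)
    (hx : ∀ p : Ideal R, p.IsPrime → p.height = 1 → ∃ a b : R, b ∉ p ∧
      algebraMap R K b * x = algebraMap R K a) : ∃ a, algebraMap R K a = x := by
  by_contra hnot
  let N : Submodule R K := LinearMap.range (Algebra.linearMap R K)
  have hxN : x ∉ N := fun ⟨a, ha⟩ => hnot ⟨a, ha⟩
  have hx0 : (N.mkQ x) ≠ 0 := by
    rw [Submodule.mkQ_apply, Ne, Submodule.Quotient.mk_eq_zero]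
    exact hxN
  -- In `K / R` take an associated prime `P` containing the annihilator of the class of `x`; it is
  -- the set of `r` with `r z ∈ R` for some `z`.
  obtain ⟨P, hP, hle⟩ := exists_le_isAssociatedPrime_of_isNoetherianRing R (N.mkQ x) hx0
  have hPprime := hP.1
  obtain ⟨-, z', hz'⟩ := isAssociatedPrime_iff.mp hP
  obtain ⟨z, rfl⟩ := Submodule.mkQ_surjective N z'
  have hmemP : ∀ r : R, r ∈ P ↔ ∃ s, algebraMap R K s = algebraMap R K r * z := by
    intro r
    rw [hz', Submodule.mem_colon_singleton, ← map_smul, Submodule.mem_bot, Submodule.mkQ_apply,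
      Submodule.Quotient.mk_eq_zero, Algebra.smul_def]
    rfl
  have hinj : Function.Injective (algebraMap R K) := IsFractionRing.injective R K
  have hP0 : P ≠ ⊥ := by
    obtain ⟨a, b, hb, rfl⟩ := IsFractionRing.div_surjective (A := R) z
    intro h
    have : b ∈ P := (hmemP b).mpr ⟨a, by
      rw [mul_div_cancel₀]
      exact fun h0 => nonZeroDivisors.ne_zero hb (hinj (h0.trans (map_zero _).symm))⟩
    rw [h] at this
    exact nonZeroDivisors.ne_zero hb this
  -- If `t z ∉ P` for some `t ∈ P`, then `P` is minimal over `(t)`, hence of height one, and `hx`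
  -- supplies a denominator of `x` outside `P`. Otherwise `z P ⊆ P`, so `z` is integral, lies in
  -- `R`, and `P` is the unit ideal.
  by_cases hcase : ∃ t ∈ P, ∃ w, w ∉ P ∧ algebraMap R K w = algebraMap R K t * z
  · obtain ⟨t, ht, w, hw, htw⟩ := hcase
    have hmin : P ∈ (Ideal.span {t}).minimalPrimes := by
      refine ⟨⟨hPprime, (Ideal.span_singleton_le_iff_mem P).mpr ht⟩, fun Q hQ hQP r hr => ?_⟩
      obtain ⟨s, hs⟩ := (hmemP r).mp hr
      have h1 : r * w = s * t := by
        apply hinj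
        rw [map_mul, map_mul, htw, hs]; ring
      have h2 : r * w ∈ Q := by
        rw [h1]
        exact Q.mul_mem_left s (hQ.2 (Ideal.mem_span_singleton_self t))
      exact (hQ.1.mem_or_mem h2).resolve_right fun h => hw (hQP h)
    have hle1 := Ideal.height_le_one_of_isPrincipal_of_mem_minimalPrimes _ P hmin
    have hheight : P.height = 1 := by
      refine le_antisymm hle1 ?_
      rw [Order.one_le_iff_ne_zero]
      exact fun h => hP0 (Ideal.height_eq_zero_iff_eq_bot.mp h)
    obtain ⟨a, b, hb, hab⟩ := hx P hPprime hheight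
    refine hb (hle ?_)
    rw [Submodule.mem_colon_singleton, ← map_smul, Submodule.mem_bot, Submodule.mkQ_apply,
      Submodule.Quotient.mk_eq_zero, Algebra.smul_def]
    exact ⟨a, hab.symm⟩
  · push Not at hcase
    have hint : IsIntegral R z := by
      refine isIntegral_of_smul_mem_submodule (M := K)
        (Submodule.map (Algebra.linearMap R K) P) ?_ (Submodule.FG.map _ (IsNoetherian.noetherian P))
        z ?_
      · obtain ⟨r, hr, hr0⟩ := Submodule.exists_mem_ne_zero_of_ne_bot hP0
        refine Submodule.ne_bot_iff _ |>.mpr ⟨algebraMap R K r, ⟨r, hr, rfl⟩, fun h => hr0 ?_⟩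
        exact hinj (h.trans (map_zero _).symm)
      · rintro _ ⟨r, hr, rfl⟩
        obtain ⟨s, hs⟩ := (hmemP r).mp hr
        refine ⟨s, ?_, ?_⟩
        · by_contra hsP
          exact hcase r hr s hsP hs
        · rw [Algebra.linearMap_apply, Algebra.linearMap_apply, hs, smul_eq_mul, mul_comm]
    obtain ⟨s, hs⟩ := IsIntegrallyClosed.isIntegral_iff.mp hint
    refine hPprime.ne_top ((Ideal.eq_top_iff_one P).mpr ((hmemP 1).mpr ⟨s, ?_⟩))
    rw [hs, map_one, one_mul]

end Hartogs

/-! ### Orders along prime divisors and sections over affine opens. -/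

namespace NormalProjectiveVariety

variable {k : Type u} [Field k] (V : NormalProjectiveVariety k)

section Stalk

variable {V} (E : V.PrimeDivisor)

theorem ord_algebraMap_stalk_nonneg {x : V.X.presheaf.stalk E.1} (hx : x ≠ 0) :
    0 ≤ Scheme.ord (algebraMap (V.X.presheaf.stalk E.1) V.functionField x) E.1 := by
  have hx' : algebraMap (V.X.presheaf.stalk E.1) V.functionField x ≠ 0 := by
    rwa [Ne, FaithfulSMul.algebraMap_eq_zero_iff]
  rw [Scheme.le_ord_iff E.2 hx']
  have := krullDimLE_of_coheight_le E.2.le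
  exact Ring.ordFrac_ge_one_of_ne_zero hx

theorem isUnit_stalk_iff_ord_eq_zero {x : V.X.presheaf.stalk E.1} (hx : x ≠ 0) :
    IsUnit x ↔ Scheme.ord (algebraMap (V.X.presheaf.stalk E.1) V.functionField x) E.1 = 0 := by
  have hx' : algebraMap (V.X.presheaf.stalk E.1) V.functionField x ≠ 0 := by
    rwa [Ne, FaithfulSMul.algebraMap_eq_zero_iff]
  rw [Scheme.ord_eq_iff E.2 hx']
  exact Ring.isUnit_iff_ordFrac_one_of_isDiscreteValuationRing

/-- The stalk is a valuation ring: if it contains `f⁻¹` instead, that element has order zero and is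
a unit. -/
theorem exists_algebraMap_stalk_eq {f : V.functionField} (hf : f ≠ 0)
    (h : 0 ≤ Scheme.ord f E.1) :
    ∃ x, algebraMap (V.X.presheaf.stalk E.1) V.functionField x = f := by
  obtain ⟨x, hx⟩ | ⟨x, hx⟩ := ValuationRing.isInteger_or_isInteger (V.X.presheaf.stalk E.1) f
  · exact ⟨x, hx⟩
  have hx0 : x ≠ 0 := by
    rintro rfl
    rw [map_zero] at hx
    exact inv_ne_zero hf hx.symm
  have h1 := ord_algebraMap_stalk_nonneg E hx0
  have h2 : Scheme.ord (f * f⁻¹) E.1 = Scheme.ord f E.1 + Scheme.ord f⁻¹ E.1 :=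
    Scheme.ord_mul hf (inv_ne_zero hf)
  have h3 : Scheme.ord (f * f⁻¹) E.1 = 0 := by
    rw [mul_inv_cancel₀ hf]
    simpa using (isUnit_stalk_iff_ord_eq_zero E (x := 1) one_ne_zero).mp isUnit_one
  rw [hx] at h1
  obtain ⟨u, rfl⟩ := (isUnit_stalk_iff_ord_eq_zero E hx0).mpr (by rw [hx]; lia)
  refine ⟨(u⁻¹ : (V.X.presheaf.stalk E.1)ˣ), ?_⟩
  rw [← inv_inv f, ← hx]
  refine eq_inv_of_mul_eq_one_left ?_
  rw [← map_mul, Units.inv_mul, map_one]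

end Stalk

section Affine

variable {V} {U : V.X.Opens} (hU : IsAffineOpen U) [Nonempty U]

include hU in
theorem isIntegrallyClosed_of_isAffineOpen : IsIntegrallyClosed Γ(V.X, U) := by
  refine IsIntegrallyClosed.of_localization_maximal fun p _ hp => ?_
  have hyU : hU.fromSpec ⟨p, hp.isPrime⟩ ∈ U := (hU.isoSpec.inv _).2
  let := TopCat.Presheaf.algebra_section_stalk V.X.presheaf
    ⟨hU.fromSpec ⟨p, hp.isPrime⟩, hyU⟩
  have : IsLocalization.AtPrime (V.X.presheaf.stalk (hU.fromSpec ⟨p, hp.isPrime⟩)) p :=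
    hU.isLocalization_stalk' ⟨p, hp.isPrime⟩ hyU
  have := V.isNormal (hU.fromSpec ⟨p, hp.isPrime⟩)
  exact this.of_equiv (IsLocalization.algEquiv p.primeCompl _ _).toRingEquiv

omit [Nonempty U] in
theorem height_primeIdealOf (x : U) :
    ((hU.primeIdealOf x).asIdeal.height : WithBot ℕ∞) = (coheight x.1 : WithBot ℕ∞) := by
  let := TopCat.Presheaf.algebra_section_stalk V.X.presheaf x
  have := hU.isLocalization_stalk x
  rw [← ringKrullDim_stalk_eq_coheight,
    IsLocalization.AtPrime.ringKrullDim_eq_height (hU.primeIdealOf x).asIdeal]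

omit [Nonempty U] in
theorem exists_primeIdealOf_eq (p : PrimeSpectrum Γ(V.X, U)) : ∃ x : U, hU.primeIdealOf x = p :=
  ⟨hU.isoSpec.inv p, by
    change (hU.isoSpec.inv ≫ hU.isoSpec.hom) p = p
    rw [Iso.inv_hom_id]; rfl⟩

theorem ord_section_nonneg {x : Γ(V.X, U)} (hx : x ≠ 0) (E : V.PrimeDivisor) (hE : E.1 ∈ U) :
    0 ≤ Scheme.ord (algebraMap Γ(V.X, U) V.functionField x) E.1 := by
  have h := ord_algebraMap_stalk_nonneg E (x := V.X.presheaf.germ U E.1 hE x)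
    (by rwa [Ne, map_eq_zero_iff _ (germ_injective_of_isIntegral _ _ _)])
  rwa [Scheme.algebraMap_germ_eq_germToFunctionField] at h

theorem ord_section_eq_zero_iff {x : Γ(V.X, U)} (hx : x ≠ 0) (E : V.PrimeDivisor) (hE : E.1 ∈ U) :
    Scheme.ord (algebraMap Γ(V.X, U) V.functionField x) E.1 = 0 ↔
      x ∉ (hU.primeIdealOf ⟨E.1, hE⟩).asIdeal := by
  have h := isUnit_stalk_iff_ord_eq_zero E (x := V.X.presheaf.germ U E.1 hE x)
    (by rwa [Ne, map_eq_zero_iff _ (germ_injective_of_isIntegral _ _ _)])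
  rw [Scheme.algebraMap_germ_eq_germToFunctionField] at h
  let := TopCat.Presheaf.algebra_section_stalk V.X.presheaf ⟨E.1, hE⟩
  have := hU.isLocalization_stalk ⟨E.1, hE⟩
  rw [← Ideal.mem_primeCompl_iff, ← IsLocalization.AtPrime.isUnit_to_map_iff
    (V.X.presheaf.stalk E.1) (hU.primeIdealOf ⟨E.1, hE⟩).asIdeal x]
  exact h.symm

include hU in
-- Height-one primes of the coordinate ring are the prime divisors meeting `U`, so the algebraic
-- Hartogs lemma applies.
theorem mem_range_of_ord_nonneg {f : V.functionField} (hf : f ≠ 0)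
    (h : ∀ E : V.PrimeDivisor, E.1 ∈ U → 0 ≤ Scheme.ord f E.1) :
    ∃ x, algebraMap Γ(V.X, U) V.functionField x = f := by
  have := functionField_isFractionRing_of_isAffineOpen V.X U hU
  have := isIntegrallyClosed_of_isAffineOpen hU
  have : IsNoetherianRing Γ(V.X, U) := IsLocallyNoetherian.component_noetherian ⟨U, hU⟩
  refine mem_range_algebraMap_of_height_one f fun p hp hp1 => ?_
  obtain ⟨y, hy⟩ := exists_primeIdealOf_eq hU ⟨p, hp⟩
  have hy1 : coheight y.1 = 1 := by
    have := height_primeIdealOf hU y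
    rw [hy, hp1] at this
    exact_mod_cast this.symm
  obtain ⟨g, hg⟩ := exists_algebraMap_stalk_eq ⟨y.1, hy1⟩ hf (h ⟨y.1, hy1⟩ y.2)
  let := TopCat.Presheaf.algebra_section_stalk V.X.presheaf y
  have := hU.isLocalization_stalk y
  obtain ⟨⟨a, b⟩, hab⟩ := IsLocalization.surj (hU.primeIdealOf y).asIdeal.primeCompl g
  refine ⟨a, b, ?_, ?_⟩
  · have hI : (hU.primeIdealOf y).asIdeal = p := congrArg PrimeSpectrum.asIdeal hy
    exact fun hb => b.2 (hI.ge hb)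
  · have := congrArg (algebraMap (V.X.presheaf.stalk y.1) V.functionField) hab
    rw [map_mul, hg] at this
    have h1 := IsScalarTower.algebraMap_apply Γ(V.X, U) (V.X.presheaf.stalk y.1)
      V.functionField a
    have h2 := IsScalarTower.algebraMap_apply Γ(V.X, U) (V.X.presheaf.stalk y.1)
      V.functionField b
    rw [h1, h2, mul_comm]
    exact this

open Classical in
include hU in
-- For `b` take functions vanishing along the components of `D` that meet `U`, to powers that round
-- up the absolute values of the real coefficients. Then `b ^ n` absorbs all poles allowed by `n D`
-- on `U`.
theorem exists_pow_mul_mem_range_of_mem_sections (D : V.RWeilDivisor) :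
    ∃ b : Γ(V.X, U), b ≠ 0 ∧ ∀ (n : ℕ), ∀ f ∈ V.sections (n • D),
      ∃ x, algebraMap Γ(V.X, U) V.functionField x =
        algebraMap Γ(V.X, U) V.functionField b ^ n * f := by
  have hex : ∀ E : V.PrimeDivisor, ∃ t : Γ(V.X, U), t ≠ 0 ∧
      (E.1 ∈ U → 1 ≤ Scheme.ord (algebraMap Γ(V.X, U) V.functionField t) E.1) := by
    intro E
    by_cases hE : E.1 ∈ U
    · have h1 := height_primeIdealOf hU ⟨E.1, hE⟩
      rw [E.2] at h1
      have hne : (hU.primeIdealOf ⟨E.1, hE⟩).asIdeal ≠ ⊥ := by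
        intro h0
        rw [h0, Ideal.height_bot] at h1
        exact absurd h1 (by simp)
      obtain ⟨t, ht, ht0⟩ := Submodule.exists_mem_ne_zero_of_ne_bot hne
      refine ⟨t, ht0, fun _ => ?_⟩
      have h2 := ord_section_nonneg ht0 E hE
      have h3 := (ord_section_eq_zero_iff hU ht0 E hE).not.mpr (not_not.mpr ht)
      lia
    · exact ⟨1, one_ne_zero, fun h => absurd h hE⟩
  choose t ht0 ht using hex
  have hinj : Function.Injective (algebraMap Γ(V.X, U) V.functionField) :=
    V.X.germToFunctionField_injective U
  have hpow : ∀ (g : V.functionField), g ≠ 0 → ∀ (E : V.PrimeDivisor) (m : ℕ),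
      Scheme.ord (g ^ m) E.1 = m * Scheme.ord g E.1 := by
    intro g hg E m
    induction m with
    | zero =>
      simpa using (isUnit_stalk_iff_ord_eq_zero E (x := 1) one_ne_zero).mp isUnit_one
    | succ m ih =>
      rw [pow_succ, Scheme.ord_mul (pow_ne_zero _ hg) hg, ih]
      push_cast; ring
  refine ⟨∏ E ∈ D.support, t E ^ ⌈|D E|⌉₊, Finset.prod_ne_zero_iff.mpr fun E _ =>
    pow_ne_zero _ (ht0 E), fun n f hf => ?_⟩
  set b := ∏ E ∈ D.support, t E ^ ⌈|D E|⌉₊ with hb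
  have hb0 : b ≠ 0 := Finset.prod_ne_zero_iff.mpr fun E _ => pow_ne_zero _ (ht0 E)
  have hb0' : algebraMap Γ(V.X, U) V.functionField b ≠ 0 := by
    rwa [Ne, map_eq_zero_iff _ hinj]
  by_cases hf0 : f = 0
  · exact ⟨0, by rw [hf0, mul_zero, map_zero]⟩
  refine mem_range_of_ord_nonneg hU (mul_ne_zero (pow_ne_zero _ hb0') hf0) fun E hE => ?_
  rw [Scheme.ord_mul (pow_ne_zero _ hb0') hf0, hpow _ hb0']
  have hordb : |D E| ≤ (Scheme.ord (algebraMap Γ(V.X, U) V.functionField b) E.1 : ℝ) := by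
    by_cases hED : E ∈ D.support
    · rw [hb, ← Finset.mul_prod_erase _ _ hED, map_mul, map_pow]
      have h1 : algebraMap Γ(V.X, U) V.functionField (t E) ≠ 0 := by
        rw [Ne, map_eq_zero_iff _ hinj]; exact ht0 E
      have h2 : (∏ F ∈ D.support.erase E, t F ^ ⌈|D F|⌉₊) ≠ 0 :=
        Finset.prod_ne_zero_iff.mpr fun F _ => pow_ne_zero _ (ht0 F)
      have h3 : algebraMap Γ(V.X, U) V.functionField
          (∏ F ∈ D.support.erase E, t F ^ ⌈|D F|⌉₊) ≠ 0 := by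
        rwa [Ne, map_eq_zero_iff _ hinj]
      rw [Scheme.ord_mul (pow_ne_zero _ h1) h3, hpow _ h1]
      have h4 := ord_section_nonneg h2 E hE
      have h5 : (⌈|D E|⌉₊ : ℤ) ≤
          ⌈|D E|⌉₊ * Scheme.ord (algebraMap Γ(V.X, U) V.functionField (t E)) E.1 :=
        le_mul_of_one_le_right (by positivity) (ht E hE)
      have h6 : (⌈|D E|⌉₊ : ℤ) ≤
          ⌈|D E|⌉₊ * Scheme.ord (algebraMap Γ(V.X, U) V.functionField (t E)) E.1 +
          Scheme.ord (algebraMap Γ(V.X, U) V.functionField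
            (∏ F ∈ D.support.erase E, t F ^ ⌈|D F|⌉₊)) E.1 := by lia
      refine (Nat.le_ceil _).trans ?_
      exact_mod_cast h6
    · rw [Finsupp.notMem_support_iff.mp hED, abs_zero]
      exact_mod_cast ord_section_nonneg hb0 E hE
  have h1 := hf hf0 E
  rw [Finsupp.smul_apply, nsmul_eq_mul] at h1
  have h2 : (n : ℝ) * D E ≤
      n * (Scheme.ord (algebraMap Γ(V.X, U) V.functionField b) E.1 : ℝ) :=
    mul_le_mul_of_nonneg_left ((le_abs_self _).trans hordb) (Nat.cast_nonneg n)
  have h3 : (0 : ℝ) ≤ n * (Scheme.ord (algebraMap Γ(V.X, U) V.functionField b) E.1 : ℝ) +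
      Scheme.ord f E.1 := by linarith
  exact_mod_cast h3

end Affine

end NormalProjectiveVariety

/-! ### Stalks of Proj and the degree-zero scalars. -/

section ProjStalk

variable {A : Type u} [CommRing A] {σ : Type*} [SetLike σ A] [AddSubgroupClass σ A]
  (𝒜 : ℕ → σ) [GradedRing 𝒜]

open HomogeneousLocalization

theorem AlgebraicGeometry.Proj.awayToSection_germ_stalkIso (f : A) (x : Proj 𝒜)
    (hx : x ∈ Proj.basicOpen 𝒜 f) :
    Proj.awayToSection 𝒜 f ≫ (Proj 𝒜).presheaf.germ _ x hx =
      CommRingCat.ofHom (HomogeneousLocalization.mapId 𝒜 (Submonoid.powers_le.mpr hx)) ≫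
        (Proj.stalkIso 𝒜 x).inv :=
  ProjectiveSpectrum.Proj.awayToSection_germ 𝒜 f x hx

/-- The computation takes place on the basic open set of `1`, which is all of Proj. -/
theorem AlgebraicGeometry.Proj.toSpecZero_appTop_germ (x : Proj 𝒜) :
    (Scheme.ΓSpecIso (.of (𝒜 0))).inv ≫ (Proj.toSpecZero 𝒜).appTop ≫
      (Proj 𝒜).presheaf.germ ⊤ x (TopologicalSpace.Opens.mem_top x) =
    CommRingCat.ofHom (fromZeroRingHom 𝒜 _) ≫ (Proj.stalkIso 𝒜 x).inv := by
  have h1 : x ∈ Proj.basicOpen 𝒜 (1 : A) := by rw [Proj.basicOpen_one]; exact TopologicalSpace.Opens.mem_top x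
  have h := Proj.awayToSection_germ_stalkIso 𝒜 1 x h1
  have h2 : (Proj.basicOpen 𝒜 (1 : A)).ι ≫ Proj.toSpecZero 𝒜 =
      Proj.basicOpenToSpec 𝒜 1 ≫ Spec.map (CommRingCat.ofHom (fromZeroRingHom 𝒜 _)) := by
    have : (Proj.basicOpen 𝒜 (1 : A)).ι ≫ (Scheme.topIso _).inv ≫
        (Scheme.isoOfEq _ (Proj.basicOpen_one 𝒜)).inv = 𝟙 _ := by
      rw [← cancel_mono (Proj.basicOpen 𝒜 (1 : A)).ι]
      simp only [Category.assoc, Scheme.isoOfEq_inv_ι, Scheme.toIso_inv_ι, Category.comp_id,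
        Category.id_comp]
    rw [Proj.toSpecZero, reassoc_of% this]
  have h3 : (Scheme.ΓSpecIso (.of (𝒜 0))).inv ≫ (Proj.toSpecZero 𝒜).appTop ≫
      (Proj 𝒜).presheaf.map (homOfLE (le_top : Proj.basicOpen 𝒜 (1 : A) ≤ ⊤)).op =
      CommRingCat.ofHom (fromZeroRingHom 𝒜 _) ≫ Proj.awayToSection 𝒜 1 := by
    have h4 := congrArg Scheme.Hom.appTop h2
    rw [Scheme.Hom.comp_appTop, Scheme.Hom.comp_appTop] at h4
    have h5 : (Proj.basicOpen 𝒜 (1 : A)).ι.appTop ≫ (Proj.basicOpen 𝒜 (1 : A)).topIso.hom =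
      (Proj 𝒜).presheaf.map (homOfLE (le_top : Proj.basicOpen 𝒜 (1 : A) ≤ ⊤)).op := by
      simp only [Scheme.Opens.ι_appTop, Scheme.Opens.topIso_hom]
      rfl
    rw [← h5, reassoc_of% h4, ← Scheme.ΓSpecIso_inv_naturality_assoc]
    have h6 := Proj.basicOpenToSpec_app_top 𝒜 (1 : A)
    rw [Scheme.Hom.appTop, h6]
    simp only [Category.assoc, Iso.inv_hom_id, Category.comp_id, Iso.inv_hom_id_assoc]
  have h7 := (Proj 𝒜).presheaf.germ_res (homOfLE (le_top : Proj.basicOpen 𝒜 (1 : A) ≤ ⊤)) x h1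
  rw [← h7, reassoc_of% h3, h, ← Category.assoc, ← CommRingCat.ofHom_comp]
  congr 2

end ProjStalk

/-! ### Standard charts of projective space. -/

section Chart

open BigDivisor HomogeneousLocalization

variable {k : Type u} [Field k] {n : ℕ}

theorem BigDivisor.X_mem_grading (j : Fin (n + 1)) :
    (MvPolynomial.X j : MvPolynomial (Fin (n + 1)) k) ∈ grading k n 1 :=
  MvPolynomial.isHomogeneous_X k j

/-- The quotient `x_l / x_j` of two coordinates. -/
noncomputable def BigDivisor.coordDiv (k : Type u) [Field k] {n : ℕ} (j l : Fin (n + 1)) :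
    Away (grading k n) (MvPolynomial.X j : MvPolynomial (Fin (n + 1)) k) :=
  Away.mk (grading k n) (X_mem_grading j) 1 (MvPolynomial.X l)
    (by rw [smul_eq_mul, one_mul]; exact X_mem_grading l)

theorem BigDivisor.val_coordDiv (j l : Fin (n + 1)) : (coordDiv k j l).val =
    Localization.mk (MvPolynomial.X l) ⟨MvPolynomial.X j, Submonoid.mem_powers _⟩ := by
  rw [coordDiv, Away.val_mk]
  congr 1
  exact Subtype.ext (pow_one _)

theorem BigDivisor.adjoin_X_eq_top : Algebra.adjoin (grading k n 0)
    (Set.range (MvPolynomial.X : Fin (n + 1) → MvPolynomial (Fin (n + 1)) k)) = ⊤ := by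
  rw [eq_top_iff]
  rintro p -
  induction p using MvPolynomial.induction_on with
  | C c => exact Subalgebra.algebraMap_mem _ (algebraMap k (grading k n 0) c)
  | add p q hp hq => exact add_mem hp hq
  | mul_X p i hp => exact mul_mem hp (Algebra.subset_adjoin (Set.mem_range_self i))

theorem BigDivisor.adjoin_coordDiv_eq_top (j : Fin (n + 1)) :
    Algebra.adjoin (grading k n 0) (Set.range (coordDiv k j)) = ⊤ := by
  rw [eq_top_iff, ← Away.adjoin_mk_prod_pow_eq_top (X_mem_grading j) (Fin (n + 1))
    (MvPolynomial.X (R := k)) adjoin_X_eq_top (fun _ => 1) (fun l => X_mem_grading l)]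
  · refine Algebra.adjoin_le ?_
    rintro _ ⟨a, e, he, -, rfl⟩
    have h : Away.mk (grading k n) (X_mem_grading j) a
        (∏ l, (MvPolynomial.X l : MvPolynomial (Fin (n + 1)) k) ^ e l)
        (he ▸ SetLike.prod_pow_mem_graded _ _ _ _ fun l _ ↦ X_mem_grading l) =
        ∏ l, coordDiv k j l ^ e l := by
      apply HomogeneousLocalization.val_injective
      rw [Away.val_mk, ← HomogeneousLocalization.algebraMap_apply, map_prod]
      simp only [map_pow, HomogeneousLocalization.algebraMap_apply, val_coordDiv,
        Localization.mk_pow]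
      rw [Localization.mk_prod]
      congr 1
      apply Subtype.ext
      simp only [smul_eq_mul, mul_one] at he
      simp [Finset.prod_pow_eq_pow_sum, he]
    rw [h]
    exact Subalgebra.prod_mem _ fun l _ => pow_mem (Algebra.subset_adjoin (Set.mem_range_self l)) _

variable {𝔭 : Ideal (MvPolynomial (Fin (n + 1)) k)} [𝔭.IsPrime]
  {K : Type u} [Field K] [Algebra k K]
  (φ : HomogeneousLocalization.AtPrime (grading k n) 𝔭 →+* K) [IsLocalHom φ]
  (hφ : ∀ c : k, φ (fromZeroRingHom (grading k n) _ (algebraMap k (grading k n 0) c)) =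
    algebraMap k K c)

/-- The quotient `x_l / x_j` in the homogeneous localization at a prime not containing `x_j`. -/
noncomputable def BigDivisor.coordDivAtPrime {j : Fin (n + 1)}
    (hj : (MvPolynomial.X j : MvPolynomial (Fin (n + 1)) k) ∉ 𝔭) (l : Fin (n + 1)) :
    HomogeneousLocalization.AtPrime (grading k n) 𝔭 :=
  mapId (grading k n) (Submonoid.powers_le.mpr hj) (coordDiv k j l)

theorem BigDivisor.val_coordDivAtPrime {j : Fin (n + 1)}
    (hj : (MvPolynomial.X j : MvPolynomial (Fin (n + 1)) k) ∉ 𝔭) (l : Fin (n + 1)) :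
    (coordDivAtPrime hj l).val = Localization.mk (MvPolynomial.X l) ⟨MvPolynomial.X j, hj⟩ := by
  rw [coordDivAtPrime, coordDiv]
  refine (congrArg val (map_mk _ _ _)).trans ?_
  rw [val_mk]
  congr 1
  exact Subtype.ext (pow_one _)

theorem BigDivisor.coordDivAtPrime_mul {j m : Fin (n + 1)}
    (hj : (MvPolynomial.X j : MvPolynomial (Fin (n + 1)) k) ∉ 𝔭)
    (hm : (MvPolynomial.X m : MvPolynomial (Fin (n + 1)) k) ∉ 𝔭) (l : Fin (n + 1)) :
    coordDivAtPrime hj l * coordDivAtPrime hm j = coordDivAtPrime hm l := by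
  apply HomogeneousLocalization.val_injective
  rw [HomogeneousLocalization.val_mul, val_coordDivAtPrime, val_coordDivAtPrime,
    val_coordDivAtPrime, Localization.mk_mul, Localization.mk_eq_mk_iff, Localization.r_iff_exists]
  exact ⟨1, by simp; ring⟩

theorem BigDivisor.coordDivAtPrime_self {j : Fin (n + 1)}
    (hj : (MvPolynomial.X j : MvPolynomial (Fin (n + 1)) k) ∉ 𝔭) :
    coordDivAtPrime hj j = 1 := by
  apply HomogeneousLocalization.val_injective
  rw [val_coordDivAtPrime, HomogeneousLocalization.val_one]
  exact Localization.mk_self (⟨_, hj⟩ : 𝔭.primeCompl)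

theorem BigDivisor.isUnit_coordDivAtPrime {j : Fin (n + 1)}
    (hj : (MvPolynomial.X j : MvPolynomial (Fin (n + 1)) k) ∉ 𝔭) {l : Fin (n + 1)}
    (hl : (MvPolynomial.X l : MvPolynomial (Fin (n + 1)) k) ∉ 𝔭) :
    IsUnit (coordDivAtPrime hj l) :=
  IsUnit.of_mul_eq_one (coordDivAtPrime hl j) (by rw [coordDivAtPrime_mul, coordDivAtPrime_self])

theorem BigDivisor.not_isUnit_coordDivAtPrime {j : Fin (n + 1)}
    (hj : (MvPolynomial.X j : MvPolynomial (Fin (n + 1)) k) ∉ 𝔭) {l : Fin (n + 1)}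
    (hl : (MvPolynomial.X l : MvPolynomial (Fin (n + 1)) k) ∈ 𝔭) :
    ¬ IsUnit (coordDivAtPrime hj l) := by
  rw [← isUnit_iff_isUnit_val, val_coordDivAtPrime, Localization.mk_eq_mk',
    IsLocalization.AtPrime.isUnit_mk'_iff (Localization.AtPrime 𝔭) 𝔭]
  exact fun h => h hl

include hφ in
-- Since `φ` is local with values in a field, coordinates lying in `𝔭` go to zero and only the
-- others generate. The quotient of the functions attached to `l` and `j` is `φ (x_l / x_j)`,
-- whatever the reference coordinate `j₀`.
theorem BigDivisor.range_comp_mapId_eq_chartAlgebra {j₀ : Fin (n + 1)}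
    (hj₀ : (MvPolynomial.X j₀ : MvPolynomial (Fin (n + 1)) k) ∉ 𝔭)
    (j : {j : Fin (n + 1) // (MvPolynomial.X j : MvPolynomial (Fin (n + 1)) k) ∉ 𝔭}) :
    Set.range (fun z => φ (mapId (grading k n) (Submonoid.powers_le.mpr j.2) z)) =
      chartAlgebra k (fun l : {j : Fin (n + 1) //
        (MvPolynomial.X j : MvPolynomial (Fin (n + 1)) k) ∉ 𝔭} =>
          φ (coordDivAtPrime hj₀ l.1)) j := by
  have hdiv : ∀ l : Fin (n + 1), φ (coordDivAtPrime hj₀ l) / φ (coordDivAtPrime hj₀ j.1) =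
      φ (coordDivAtPrime j.2 l) := by
    intro l
    rw [div_eq_iff ((isUnit_coordDivAtPrime hj₀ j.2).map φ).ne_zero, ← map_mul,
      coordDivAtPrime_mul]
  have hscal : ∀ c : grading k n 0, ∃ c' : k, c = algebraMap k (grading k n 0) c' := by
    intro c
    have hp' : c.1.totalDegree = 0 :=
      Nat.le_zero.mp (MvPolynomial.IsHomogeneous.totalDegree_le
        ((MvPolynomial.mem_homogeneousSubmodule 0 c.1).mp c.2))
    exact ⟨c.1.coeff 0, Subtype.ext (MvPolynomial.totalDegree_eq_zero_iff_eq_C.mp hp')⟩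
  have halg : ∀ c : k, φ (mapId (grading k n) (Submonoid.powers_le.mpr j.2)
      (algebraMap (grading k n 0) _ (algebraMap k (grading k n 0) c))) = algebraMap k K c := by
    intro c
    rw [← hφ]
    congr 1
  apply Set.Subset.antisymm
  · rintro _ ⟨z, rfl⟩
    have hz : z ∈ Algebra.adjoin (grading k n 0) (Set.range (coordDiv k j.1)) := by
      rw [adjoin_coordDiv_eq_top]; trivial
    induction hz using Algebra.adjoin_induction with
    | mem x hx =>
      obtain ⟨l, rfl⟩ := hx
      change φ (coordDivAtPrime j.2 l) ∈ chartAlgebra k _ j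
      by_cases hl : (MvPolynomial.X l : MvPolynomial (Fin (n + 1)) k) ∈ 𝔭
      · have : φ (coordDivAtPrime j.2 l) = 0 := by
          by_contra h
          exact not_isUnit_coordDivAtPrime j.2 hl
            (isUnit_of_map_unit φ _ (isUnit_iff_ne_zero.mpr h))
        rw [this]; exact zero_mem _
      · exact Algebra.subset_adjoin ⟨⟨l, hl⟩, hdiv l⟩
    | algebraMap c =>
      obtain ⟨c, rfl⟩ := hscal c
      simp only [halg]
      exact Subalgebra.algebraMap_mem _ c
    | add x y _ _ hx hy => simp only [map_add]; exact add_mem hx hy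
    | mul x y _ _ hx hy => simp only [map_mul]; exact mul_mem hx hy
  · intro x hx
    rw [SetLike.mem_coe, chartAlgebra] at hx
    induction hx using Algebra.adjoin_induction with
    | mem x hx =>
      obtain ⟨l, rfl⟩ := hx
      exact ⟨coordDiv k j.1 l.1, (hdiv l.1).symm⟩
    | algebraMap c => exact ⟨_, halg c⟩
    | add x y _ _ hx hy =>
      obtain ⟨a, rfl⟩ := hx
      obtain ⟨b, rfl⟩ := hy
      exact ⟨a + b, by simp only [map_add]⟩
    | mul x y _ _ hx hy =>
      obtain ⟨a, rfl⟩ := hx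
      obtain ⟨b, rfl⟩ := hy
      exact ⟨a * b, by simp only [map_mul]⟩

end Chart

/-! ### Coordinate charts of the variety. -/

namespace NormalProjectiveVariety

open BigDivisor HomogeneousLocalization

variable {k : Type u} [Field k] (V : NormalProjectiveVariety k)

/-- Ensures that the scalars coming from projective space act on the function field as those of the
structure morphism. -/
theorem stalkMap_scalars {n : ℕ} (i : V.X ⟶ projectiveSpace k n)
    (hi : i ≫ projectiveSpaceStr k n = V.str) (c : k) :
    ((Proj.stalkIso (grading k n) (i (genericPoint V.X))).inv ≫
      i.stalkMap (genericPoint V.X)).hom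
      (fromZeroRingHom (grading k n) _ (algebraMap k (grading k n 0) c)) =
    algebraMap k V.functionField c := by
  have h1 := Proj.toSpecZero_appTop_germ (grading k n) (i (genericPoint V.X))
  have h2 := Scheme.Hom.germ_stalkMap i ⊤ (genericPoint V.X) (TopologicalSpace.Opens.mem_top _)
  have h3 : CommRingCat.ofHom (algebraMap k (grading k n 0)) ≫
      CommRingCat.ofHom (fromZeroRingHom (grading k n) _) ≫
      (Proj.stalkIso (grading k n) (i (genericPoint V.X))).inv ≫
      i.stalkMap (genericPoint V.X) =
      (Scheme.ΓSpecIso (CommRingCat.of k)).inv ≫ V.str.appTop ≫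
        V.X.presheaf.germ ⊤ (genericPoint V.X) trivial := by
    rw [← reassoc_of% h1]
    erw [h2]
    rw [← hi, Scheme.Hom.comp_appTop, projectiveSpaceStr, Scheme.Hom.comp_appTop]
    simp only [Category.assoc]
    rw [← Scheme.ΓSpecIso_inv_naturality_assoc]
    rfl
  exact congrArg (fun f => f.hom c) h3

/-- The `y l` are the restrictions of `x_l / x_{j₀}`, for coordinates not vanishing at the generic
point; the other charts are empty on `X`. A closed immersion is surjective on sections over affine
opens, which yields the equality of rings. -/
theorem exists_charts : ∃ (ι : Type) (_ : Finite ι) (_ : Nonempty ι) (y : ι → V.functionField)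
    (U : ι → V.X.Opens), (∀ i, y i ≠ 0) ∧ (∀ i, IsAffineOpen (U i)) ∧ (∀ x, ∃ i, x ∈ U i) ∧
      ∀ i, ∃ _ : Nonempty (U i),
        Set.range (algebraMap Γ(V.X, U i) V.functionField) = chartAlgebra k y i := by
  obtain ⟨n, i, hcl, hi⟩ := V.isProjective
  set η := genericPoint V.X with hη
  let 𝔭 := (i η).asHomogeneousIdeal.toIdeal
  have h𝔭 : 𝔭.IsPrime := (i η).isPrime
  let I := {j : Fin (n + 1) // (MvPolynomial.X j : MvPolynomial (Fin (n + 1)) k) ∉ 𝔭}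
  let U : Fin (n + 1) → V.X.Opens := fun j =>
    i ⁻¹ᵁ Proj.basicOpen (grading k n) (MvPolynomial.X j)
  have hcover : ∀ x, ∃ j, x ∈ U j := by
    intro x
    have h := Proj.iSup_basicOpen_eq_top' (𝒜 := grading k n)
      (MvPolynomial.X : Fin (n + 1) → MvPolynomial (Fin (n + 1)) k)
      (fun j => ⟨1, X_mem_grading j⟩) adjoin_X_eq_top
    have hx : i x ∈ ⨆ j : Fin (n + 1), Proj.basicOpen (grading k n) (MvPolynomial.X j) := by
      rw [h]; exact TopologicalSpace.Opens.mem_top _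
    rw [TopologicalSpace.Opens.mem_iSup] at hx
    exact hx
  have hηU : ∀ x j, x ∈ U j → (MvPolynomial.X j : MvPolynomial (Fin (n + 1)) k) ∉ 𝔭 := by
    intro x j hx
    have : η ∈ U j := ((genericPoint_spec V.X).mem_open_set_iff (U j).isOpen).mpr
      ⟨x, trivial, hx⟩
    exact this
  obtain ⟨j₀, hj₀⟩ := hcover η
  have hj₀' := hηU _ _ hj₀
  let φ : HomogeneousLocalization.AtPrime (grading k n) 𝔭 →+* V.functionField :=
    ((Proj.stalkIso (grading k n) (i η)).inv ≫ i.stalkMap η).hom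
  have hφ : ∀ c : k, φ (fromZeroRingHom (grading k n) _ (algebraMap k (grading k n 0) c)) =
    algebraMap k V.functionField c := V.stalkMap_scalars i hi
  have hloc : IsLocalHom φ := by
    have h1 : IsLocalHom (i.stalkMap η).hom := inferInstance
    have h2 : IsLocalHom (Proj.stalkIso (grading k n) (i η)).inv.hom := isLocalHom_of_isIso _
    exact RingHom.isLocalHom_comp _ _
  refine ⟨I, inferInstance, ⟨⟨j₀, hj₀'⟩⟩, fun l => φ (coordDivAtPrime hj₀' l.1),
    fun l => U l.1, fun l => ((isUnit_coordDivAtPrime hj₀' l.2).map φ).ne_zero, fun l => ?_,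
    fun x => ?_, fun l => ⟨⟨η, l.2⟩, ?_⟩⟩
  · exact (Proj.isAffineOpen_basicOpen (grading k n) _ (X_mem_grading l.1) one_pos).preimage i
  · obtain ⟨j, hj⟩ := hcover x
    exact ⟨⟨j, hηU x j hj⟩, hj⟩
  · rw [← range_comp_mapId_eq_chartAlgebra φ hφ hj₀' l]
    have hkey : ∀ z, φ (mapId (grading k n) (Submonoid.powers_le.mpr l.2) z) =
        V.X.presheaf.germ (U l.1) η l.2 (i.app _ (Proj.awayToSection (grading k n) _ z)) := by
      intro z
      have h1 := Proj.awayToSection_germ_stalkIso (grading k n) (MvPolynomial.X l.1) (i η) l.2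
      have h2 := Scheme.Hom.germ_stalkMap i
        (Proj.basicOpen (grading k n) (MvPolynomial.X l.1)) η l.2
      have h3 : Proj.awayToSection (grading k n) (MvPolynomial.X l.1) ≫ i.app _ ≫
          V.X.presheaf.germ (U l.1) η l.2 =
          CommRingCat.ofHom (mapId (grading k n) (Submonoid.powers_le.mpr l.2)) ≫
          (Proj.stalkIso (grading k n) (i η)).inv ≫ i.stalkMap η := by
        rw [← reassoc_of% h1, h2]
      exact congrArg (fun f => f.hom z) h3.symm
    simp only [hkey]
    have hsurj : Function.Surjective (fun z => i.app _
        (Proj.awayToSection (grading k n) (MvPolynomial.X l.1) z)) := by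
      refine (i.app_surjective _ (Proj.isAffineOpen_basicOpen (grading k n) _
        (X_mem_grading l.1) one_pos)).comp ?_
      exact (ConcreteCategory.bijective_of_isIso
        (Proj.basicOpenIsoAway (grading k n) _ (X_mem_grading l.1) one_pos).hom).2
    exact (hsurj.range_comp (fun s => V.X.presheaf.germ (U l.1) η l.2 s)).symm

end NormalProjectiveVariety

/-! ### Krull dimension equals transcendence degree. -/

theorem ringKrullDim_eq_of_isIntegral (R S : Type*) [CommRing R] [CommRing S] [Algebra R S]
    [Algebra.IsIntegral R S] [FaithfulSMul R S] : ringKrullDim S = ringKrullDim R := by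
  apply le_antisymm
  · exact Order.krullDim_le_of_strictMono (PrimeSpectrum.comap (algebraMap R S))
      fun I J hIJ => Ideal.IsIntegral.comap_lt_comap hIJ
  · refine iSup_le fun l => ?_
    obtain ⟨⟨P, hP, hPl⟩⟩ := Ideal.nonempty_primesOver (S := S) l.head.asIdeal
    obtain ⟨L, hL, -, -⟩ := Ideal.exists_ltSeries_of_hasGoingUp l P
    rw [← hL]
    exact LTSeries.length_le_krullDim L

theorem IsCoordinateSystem.trdeg_lt_aleph0 {k K : Type u} [Field k] [Field K] [Algebra k K]
    {ι : Type*} [Nonempty ι] [Finite ι] {y : ι → K} (hy : IsCoordinateSystem k y) :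
    Algebra.trdeg k K < Cardinal.aleph0 := by
  let i : ι := Classical.arbitrary ι
  rw [← hy.trdeg_chartAlgebra i]
  exact trdeg_lt_aleph0_of_finiteType

theorem IsCoordinateSystem.ringKrullDim_chartAlgebra {k K : Type u} [Field k] [Field K]
    [Algebra k K] {ι : Type*} [Nonempty ι] [Finite ι] {y : ι → K} (hy : IsCoordinateSystem k y)
    {d : ℕ} (hd : Algebra.trdeg k K = d) (i : ι) : ringKrullDim (chartAlgebra k y i) = d := by
  obtain ⟨g, hg, hgf⟩ := hy.exists_noetherNormalization i hd
  let := g.toRingHom.toAlgebra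
  have : Module.Finite (MvPolynomial (Fin d) k) (chartAlgebra k y i) := hgf
  have : FaithfulSMul (MvPolynomial (Fin d) k) (chartAlgebra k y i) :=
    (faithfulSMul_iff_algebraMap_injective _ _).mpr hg
  rw [ringKrullDim_eq_of_isIntegral (MvPolynomial (Fin d) k) (chartAlgebra k y i),
    MvPolynomial.ringKrullDim_of_isNoetherianRing, ringKrullDim_eq_zero_of_field, Nat.card_fin,
    zero_add]

namespace NormalProjectiveVariety

variable {k : Type u} [Field k] (V : NormalProjectiveVariety k)

theorem exists_isCoordinateSystem : ∃ (ι : Type) (_ : Finite ι) (_ : Nonempty ι)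
    (y : ι → V.functionField) (U : ι → V.X.Opens), IsCoordinateSystem k y ∧
      (∀ i, IsAffineOpen (U i)) ∧ (∀ x, ∃ i, x ∈ U i) ∧
      ∀ i, ∃ (_ : Nonempty (U i)) (e : Γ(V.X, U i) ≃+* chartAlgebra k y i),
        ∀ x, (e x : V.functionField) = algebraMap Γ(V.X, U i) V.functionField x := by
  obtain ⟨ι, hfin, hne, y, U, hy, hU, hcov, hrange⟩ := V.exists_charts
  have he : ∀ i, ∃ (_ : Nonempty (U i)) (e : Γ(V.X, U i) ≃+* chartAlgebra k y i),
      ∀ x, (e x : V.functionField) = algebraMap Γ(V.X, U i) V.functionField x := by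
    intro i
    obtain ⟨hn, hr⟩ := hrange i
    have hmem : ∀ x, algebraMap Γ(V.X, U i) V.functionField x ∈ chartAlgebra k y i := fun x =>
      hr.le (Set.mem_range_self x)
    refine ⟨hn, RingEquiv.ofBijective
      ((algebraMap Γ(V.X, U i) V.functionField).codRestrict (chartAlgebra k y i) hmem) ⟨?_, ?_⟩,
      fun x => rfl⟩
    · intro a b hab
      exact V.X.germToFunctionField_injective (U i) (congrArg Subtype.val hab)
    · rintro ⟨b, hb⟩
      obtain ⟨a, ha⟩ := hr.ge hb
      exact ⟨a, Subtype.ext ha⟩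
  refine ⟨ι, hfin, hne, y, U, ⟨hy, fun i x => ?_⟩, hU, hcov, he⟩
  obtain ⟨hn, e, he⟩ := he i
  have := functionField_isFractionRing_of_isAffineOpen V.X (U i) (hU i)
  obtain ⟨a, b, hb, rfl⟩ := IsFractionRing.div_surjective (A := Γ(V.X, U i)) x
  refine ⟨e a, (e a).2, e b, (e b).2, ?_, by rw [he, he]⟩
  rw [Ne, ZeroMemClass.coe_eq_zero, EmbeddingLike.map_eq_zero_iff]
  exact nonZeroDivisors.ne_zero hb

theorem topologicalKrullDim_eq {ι : Type*} [Nonempty ι] {U : ι → V.X.Opens}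
    (hU : ∀ i, IsAffineOpen (U i)) (hcov : ∀ x, ∃ i, x ∈ U i) {d : ℕ}
    (hd : ∀ i, ringKrullDim Γ(V.X, U i) = d) : topologicalKrullDim V.X = d := by
  apply le_antisymm
  · rw [topologicalKrullDim, Order.krullDim_eq_of_orderIso irreducibleSetEquivPoints,
      Order.krullDim_eq_iSup_coheight]
    refine iSup_le fun x => ?_
    obtain ⟨i, hi⟩ := hcov x
    rw [← height_primeIdealOf (hU i) ⟨x, hi⟩, ← hd i]
    exact Ideal.height_le_ringKrullDim_of_ne_top
      ((hU i).primeIdealOf ⟨x, hi⟩).isPrime.ne_top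
  · let i : ι := Classical.arbitrary ι
    rw [← hd i, ← PrimeSpectrum.topologicalKrullDim_eq_ringKrullDim Γ(V.X, U i)]
    change topologicalKrullDim (Spec Γ(V.X, U i)) ≤ _
    rw [← IsHomeomorph.topologicalKrullDim_eq _ (hU i).isoSpec.hom.homeomorph.isHomeomorph]
    exact topologicalKrullDim_subspace_le V.X (U i)

end NormalProjectiveVariety

/-! ### The graded systems of sections and the conclusion. -/

namespace NormalProjectiveVariety

variable {k : Type u} [Field k] (V : NormalProjectiveVariety k)

theorem dim_eq_of_topologicalKrullDim_eq {d : ℕ} (h : topologicalKrullDim V.X = d) :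
    V.dim = d := by
  rw [dim, h]
  rfl

variable {V}

theorem mem_sections_nsmul_iff {D : V.RWeilDivisor} {n : ℕ} {f : V.functionField} :
    f ∈ V.sections (n • D) ↔
      (f ≠ 0 → ∀ E : V.PrimeDivisor, 0 ≤ (Scheme.ord f E.1 : ℝ) + n * D E) := by
  change (f ≠ 0 → ∀ E : V.PrimeDivisor, 0 ≤ (Scheme.ord f E.1 : ℝ) + (n • D) E) ↔ _
  simp only [Finsupp.smul_apply, nsmul_eq_mul]

theorem sections_mono {D D' : V.RWeilDivisor} (h : D ≤ D') (n : ℕ) :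
    V.sections (n • D) ≤ V.sections (n • D') := by
  intro f hf
  rw [mem_sections_nsmul_iff] at hf ⊢
  intro hf0 E
  have h1 := hf hf0 E
  have h2 : (n : ℝ) * D E ≤ n * D' E := mul_le_mul_of_nonneg_left (h E) (Nat.cast_nonneg n)
  linarith

theorem ord_one (E : V.PrimeDivisor) : Scheme.ord (1 : V.functionField) E.1 = 0 := by
  simpa using (isUnit_stalk_iff_ord_eq_zero E (x := 1) one_ne_zero).mp isUnit_one

theorem one_mem_sections (D : V.RWeilDivisor) : (1 : V.functionField) ∈ V.sections (0 • D) := by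
  rw [mem_sections_nsmul_iff]
  intro _ E
  rw [ord_one]
  simp

theorem mul_mem_sections (D : V.RWeilDivisor) (m n : ℕ) :
    ∀ a ∈ V.sections (m • D), ∀ b ∈ V.sections (n • D), a * b ∈ V.sections ((m + n) • D) := by
  intro a ha b hb
  rw [mem_sections_nsmul_iff] at *
  intro hab E
  obtain ⟨ha0, hb0⟩ := mul_ne_zero_iff.mp hab
  have h1 := ha ha0 E
  have h2 := hb hb0 E
  rw [Scheme.ord_mul ha0 hb0]
  push_cast
  linarith

theorem hasBoundedPoles_sections {ι : Type*} {y : ι → V.functionField} {U : ι → V.X.Opens}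
    (hU : ∀ i, IsAffineOpen (U i))
    (he : ∀ i, ∃ (_ : Nonempty (U i)) (e : Γ(V.X, U i) ≃+* chartAlgebra k y i),
      ∀ x, (e x : V.functionField) = algebraMap Γ(V.X, U i) V.functionField x)
    (D : V.RWeilDivisor) : HasBoundedPoles k y fun n => V.sections (n • D) := by
  intro i
  obtain ⟨hn, e, he⟩ := he i
  obtain ⟨b, hb0, hb⟩ := exists_pow_mul_mem_range_of_mem_sections (hU i) D
  refine ⟨e b, (e b).2, ?_, fun n f hf => ?_⟩
  · rwa [Ne, ZeroMemClass.coe_eq_zero, EmbeddingLike.map_eq_zero_iff]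
  · obtain ⟨x, hx⟩ := hb n f hf
    rw [he, ← hx, ← he]
    exact (e x).2

theorem exists_order_le_of_mem_sections {ι : Type*} [Nonempty ι] [Finite ι]
    {y : ι → V.functionField} {U : ι → V.X.Opens} (hy : IsCoordinateSystem k y)
    (hU : ∀ i, IsAffineOpen (U i)) (hcov : ∀ x, ∃ i, x ∈ U i)
    (he : ∀ i, ∃ (_ : Nonempty (U i)) (e : Γ(V.X, U i) ≃+* chartAlgebra k y i),
      ∀ x, (e x : V.functionField) = algebraMap Γ(V.X, U i) V.functionField x)
    {d : ℕ} (hd : Algebra.trdeg k V.functionField = d) (hd0 : d ≠ 0) (D : V.RWeilDivisor)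
    (E : V.PrimeDivisor) :
    ∃ C : ℕ, ∀ n : ℕ, ∀ f ∈ V.sections (n • D), f ≠ 0 → Scheme.ord f E.1 ≤ C * (n + 1) := by
  obtain ⟨i, hi⟩ := hcov E.1
  have hV := hasBoundedPoles_sections hU he D
  obtain ⟨hn, e, he⟩ := he i
  let p : Ideal (chartAlgebra k y i) :=
    ((hU i).primeIdealOf ⟨E.1, hi⟩).asIdeal.comap (e.symm : chartAlgebra k y i →+* Γ(V.X, U i))
  have hp : p.IsPrime := Ideal.comap_isPrime _ _
  have hp1 : p.height = 1 := by
    have h := height_primeIdealOf (hU i) ⟨E.1, hi⟩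
    rw [E.2] at h
    have h1 : ((hU i).primeIdealOf ⟨E.1, hi⟩).asIdeal.height = 1 := by exact_mod_cast h
    rw [← h1]
    exact RingEquiv.height_comap e.symm _
  have hval : ∀ x : chartAlgebra k y i,
      algebraMap Γ(V.X, U i) V.functionField (e.symm x) = x := fun x => by
    rw [← he, RingEquiv.apply_symm_apply]
  refine exists_order_le (v := fun f => Scheme.ord f E.1) hy hd hd0 hV (fun a b ha hb => Scheme.ord_mul ha hb) i p hp1 ?_ ?_
  · intro x hx
    rw [← hval]
    exact ord_section_nonneg (by rwa [Ne, EmbeddingLike.map_eq_zero_iff]) E hi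
  · intro x hx hxp
    rw [← hval]
    exact (ord_section_eq_zero_iff (hU i) (by rwa [Ne, EmbeddingLike.map_eq_zero_iff]) E hi).mpr hxp

/-- Adding a divisor that does not change a positive volume does not change the sections. -/
theorem sections_eq_of_vol_eq {D₁ D₂ : V.RWeilDivisor} (hD₁ : V.IsBig D₁) (hle : D₁ ≤ D₂)
    (hvol : V.vol D₁ = V.vol D₂) (n : ℕ) : V.sections (n • D₁) = V.sections (n • D₂) := by
  refine le_antisymm (sections_mono hle n) fun f hf => ?_
  by_contra hfn
  rw [mem_sections_nsmul_iff] at hfn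
  push Not at hfn
  obtain ⟨hf0, E, hE⟩ := hfn
  -- In degree zero both spaces impose the same condition, so a discrepancy needs positive degree.
  have hn0 : 0 < n := by
    rcases Nat.eq_zero_or_pos n with rfl | h
    · have := mem_sections_nsmul_iff.mp hf hf0 E
      simp only [Nat.cast_zero, zero_mul] at this hE
      exact absurd this (not_le.mpr hE)
    · exact h
  obtain ⟨ι, hfin, hne, y, U, hy, hU, hcov, he⟩ := V.exists_isCoordinateSystem
  obtain ⟨d, hd⟩ := Cardinal.lt_aleph0.mp hy.trdeg_lt_aleph0
  have hdimU : ∀ i, ringKrullDim Γ(V.X, U i) = d := fun i => by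
    obtain ⟨_, e, -⟩ := he i
    rw [ringKrullDim_eq_of_ringEquiv e, hy.ringKrullDim_chartAlgebra hd]
  have hdim : V.dim = d := V.dim_eq_of_topologicalKrullDim_eq (V.topologicalKrullDim_eq hU hcov hdimU)
  -- The divisor `E` is a point of codimension one, which rules out dimension zero.
  have hd0 : d ≠ 0 := by
    rintro rfl
    obtain ⟨i, hi⟩ := hcov E.1
    have h1 := height_primeIdealOf (hU i) ⟨E.1, hi⟩
    have h2 := Ideal.height_le_ringKrullDim_of_ne_top
      ((hU i).primeIdealOf ⟨E.1, hi⟩).isPrime.ne_top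
    rw [h1, E.2, hdimU i] at h2
    exact absurd h2 (by decide)
  have hV₁ := hasBoundedPoles_sections hU he D₁
  have hV₂ := hasBoundedPoles_sections hU he D₂
  obtain ⟨hfin₁, C₁, hC₁⟩ := hy.finite_and_finrank_le hd hd0 hV₁
  obtain ⟨hfin₂, -⟩ := hy.finite_and_finrank_le hd hd0 hV₂
  rw [IsBig, vol, hdim] at hD₁
  obtain ⟨P, hP, hgrow⟩ := exists_pow_le_finrank hy hd hd0 hV₁ (one_mem_sections D₁)
    (mul_mem_sections D₁) (not_exists_bound_of_limsup_pos hD₁)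
  obtain ⟨C, hC⟩ := exists_order_le_of_mem_sections hy hU hcov he hd hd0 D₁ E
  obtain ⟨R, n₀, hR, hadd⟩ := exists_finrank_add_le (V := fun n => V.sections (n • D₁))
    (W := fun n => V.sections (n • D₂)) (v := fun f => Scheme.ord f E.1) (a := D₁ E) (d := d)
    (sections_mono hle) hfin₂ (one_mem_sections D₂) (mul_mem_sections D₁) (mul_mem_sections D₂)
    (fun a b ha hb => Scheme.ord_mul ha hb)
    (fun n f hf hf0 => by
      have := mem_sections_nsmul_iff.mp hf hf0 E
      linarith)
    hC hn0 hf0 hf (by linarith) hP hgrow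
  have hlt := limsup_lt_limsup_of_add_le (b := fun n => Module.finrank k (V.sections (n • D₂)))
    hR hC₁ (fun n hn h0 => hadd n hn fun (hbot : V.sections (n • D₁) = ⊥) =>
      h0 (by rw [hbot, finrank_bot])) hD₁
  rw [vol, vol, hdim] at hvol
  exact hlt.ne hvol

end NormalProjectiveVariety

theorem mainTheorem11 {k : Type u} [Field k] (V : NormalProjectiveVariety k)
    (D₁ D₂ : V.RWeilDivisor) (hD₁ : V.IsBig D₁) (hD₂ : V.IsBig D₂)
    (hle : D₁ ≤ D₂) (hvol : V.vol D₁ = V.vol D₂) (n : ℕ) :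
    V.sections (n • D₁) = V.sections (n • D₂) :=
  NormalProjectiveVariety.sections_eq_of_vol_eq hD₁ hle hvol n
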